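/- Let $\mathcal C=(C_1,\dots,C_s)$ be a Clifford circuit on $n$ qubits: each $C_i$ is either a Clifford unitary gate acting on a set of qubits or the measurement of a Pauli operator (a tensor product of $I,X,Y,Z$ with a sign), and has a level in $\{1,2,\dots\}$; levels are non-decreasing in $i$ and operations of the same level act on disjoint sets of qubits. Let $\Delta$ be the maximum level, let $S_1,\dots,S_m$ be the measured operators and $\ell_j$ the level of $S_j$. Let $\mathcal O(\mathcal C)\subseteq\mathbb Z_2^m$ be the set of outcome bit-strings that have non-zero probability for some input state, and assume that it is a linear code; let $\mathcal O(\mathcal C)^\perp$ be its dual code. A fault operator is a Pauli operator, up to phase, on the $n(\Delta+1)$ qubits $(\ell+0.5,q)$ with $0\le\ell\le\Delta$, $1\le q\le n$; its weight is the number of qubits on which it is not the identity. Its back-cumulant is obtained by taking $\ell=\Delta,\Delta-1,\dots,1$ in turn and multiplying the component at level $\ell-0.5$ by $U_\ell^{-1}EU_\ell$, where $E$ is the current component at level $\ell+0.5$ and $U_\ell$ is the product of the unitary gates of level $\ell$. For $u\in\mathbb Z_2^m$ let $F(u)$ be the product over $j$ of the operators $S_j^{u_j}$ placed at level $\ell_j-0.5$.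 The stabilizers (up to phase) of the spacetime code of $\mathcal C$ are the back-cumulants $\overleftarrow{F(u)}$ with $u\in\mathcal O(\mathcal C)^\perp$. The spacetime graph $G$ has the vertices $(\ell+0.5,q)$ with $0\le\ell\le\Delta-1$, and two distinct vertices are adjacent if and only if, for some operation of some level $\ell$, both are of the form $(\ell\pm0.5,q)$ with $q$ a qubit on which this operation acts. A stabilizer is connected if its support is a non-empty connected set of vertices of $G$. For an integer $M\ge0$, consider the following algorithm. 1. Compute affine checks of $\mathcal O(\mathcal C)$ by stabilizer simulation. Start with an empty set $\mathcal S_0$ of signed Pauli operators, each of which carries a vector of $\mathbb Z_2^m$, and process $C_1,\dots,C_s$ in turn. A gate $U$ replaces each $T\in\mathcal S_0$ by $UTU^{-1}$, with the same vector. For a measurement of $S_j$: if $S_j$ or $-S_j$ lies in $\langle\mathcal S_0\rangle$, decompose it as a product of elements of $\mathcal S_0$, let $w$ be the sum of their vectors, and add the check $o_j+(w\,|\,o)=0$ for $S_j$, or $=1$ for $-S_j$. Otherwise, if some $T\in\mathcal S_0$ anticommutes with $S_j$, choose one, multiply every other anticommuting $T'\in\mathcal S_0$ by $T$ (adding the vectors),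 and remove $T$; then, whether or not such a $T$ existed, add $S_j$ with vector $e_j$ to $\mathcal S_0$. Let $u_1,\dots,u_r\in\mathbb Z_2^m$ be the coefficient vectors of the checks found. 2. Let $\mathcal S=\{\overleftarrow{F(u_1)},\dots,\overleftarrow{F(u_r)}\}$ and choose logical operators $\bar X_1,\bar Z_1,\dots,\bar X_K,\bar Z_K$: they satisfy the canonical commutation relations and, together with $\mathcal S$, generate the group of all Pauli operators, up to phase, that commute with $\mathcal S$. 3. For each vertex $v$ of $G$, let $A$ be the ball of radius $\lfloor M/2\rfloor$ around $v$ in $G$. Restrict the elements of $\mathcal S$ and the logical operators to $A$, drop the trivial ones, and compute a reduced row echelon form $\mathbf G$, without zero rows, of the binary matrix with these rows. Choose operators $\mathbf H_i$ supported on $A$ such that $\mathbf H_i$ anticommutes with $\mathbf G_i$ and commutes with every other $\mathbf G_j$. For each of the $2|A|$ single-qubit operators $X_a,Z_a$ with $a\in A$, go through $j=1,2,\dots$ and multiply it by $\mathbf H_j$ if it anticommutes with $\mathbf G_j$; let $\mathcal S(A)$ be the set of the resulting operators. Add to the output every element of $\langle\mathcal S(A)\rangle$ of weight at most $M$ whose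 support has exactly one connected component in $G$. Then the algorithm can always be carried out (all required choices exist), and, whatever choices are made, its output is exactly the set of all connected stabilizers of the spacetime code of $\mathcal C$ with weight at most $M$. -/

import Mathlib

/-! ### Pauli operators up to phase -/

/-- Pauli operators, up to a phase, on the qubits indexed by `Q`. The component on a qubit is
`(0,0) = I`, `(1,0) = X`, `(0,1) = Z`, `(1,1) = Y`; the product of Pauli operators up to phase is
addition. -/
abbrev PauliBar (Q : Type) : Type := Q → ZMod 2 × ZMod 2

namespace PauliBar

variable {Q : Type} [Fintype Q] [DecidableEq Q]

/-- The set of qubits on which `P` is not the identity. -/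
def support (P : PauliBar Q) : Finset Q := Finset.univ.filter fun q => P q ≠ 0

/-- The number of qubits on which `P` is not the identity. -/
def weight (P : PauliBar Q) : ℕ := P.support.card

/-- The commutator `[P, P']`: `0` if the operators commute and `1` if they anticommute. -/
def comm (P P' : PauliBar Q) : ZMod 2 :=
  ∑ q, ((P q).1 * (P' q).2 + (P q).2 * (P' q).1)

/-- The restriction of `P` to a set `A` of qubits: components outside of `A` are set to `I`. -/
def restrict (A : Finset Q) (P : PauliBar Q) : PauliBar Q := fun q => if q ∈ A then P q else 0

/-- The entry of `P`, seen as a row of a binary matrix with two columns per qubit. -/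
def entry (P : PauliBar Q) (c : Q × Fin 2) : ZMod 2 := if c.2 = 0 then (P c.1).1 else (P c.1).2

end PauliBar

/-! ### Pauli and Clifford operators on `n` qubits, as unitary matrices -/

/-- The four single-qubit Pauli matrices. -/
noncomputable def pauliMatrixOne (a : ZMod 2 × ZMod 2) : Matrix (Fin 2) (Fin 2) ℂ :=
  if a = (0, 0) then 1
  else if a = (1, 0) then !![0, 1; 1, 0]
  else if a = (0, 1) then !![1, 0; 0, -1]
  else !![0, -Complex.I; Complex.I, 0]

/-- The tensor product of single-qubit Pauli matrices, acting on `(ℂ²)^{⊗ n}`, whose standard basis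
is indexed by bit strings. -/
noncomputable def pauliMatrix {n : ℕ} (p : PauliBar (Fin n)) :
    Matrix (Fin n → Fin 2) (Fin n → Fin 2) ℂ :=
  Matrix.of fun b b' => ∏ q, pauliMatrixOne (p q) (b q) (b' q)

theorem pauliMatrixOne_mul_star (a : ZMod 2 × ZMod 2) :
    pauliMatrixOne a * star (pauliMatrixOne a) = 1 := by
  unfold pauliMatrixOne
  split_ifs <;> ext i j <;> fin_cases i <;> fin_cases j <;>
    simp [Matrix.mul_apply, Matrix.star_apply]

theorem pauliMatrix_mem {n : ℕ} (p : PauliBar (Fin n)) :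
    pauliMatrix p ∈ Matrix.unitaryGroup (Fin n → Fin 2) ℂ := by
  rw [Matrix.mem_unitaryGroup_iff]
  ext b b'
  have h : ∀ q : Fin n, ∑ x : Fin 2, pauliMatrixOne (p q) (b q) x *
      star (pauliMatrixOne (p q) (b' q) x) = if b q = b' q then 1 else 0 := by
    intro q
    have := congrFun (congrFun (pauliMatrixOne_mul_star (p q)) (b q)) (b' q)
    simpa [Matrix.mul_apply, Matrix.star_apply, Matrix.one_apply] using this
  have h2 : (pauliMatrix p * star (pauliMatrix p)) b b' =
      ∏ q, ∑ x : Fin 2, pauliMatrixOne (p q) (b q) x *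
        star (pauliMatrixOne (p q) (b' q) x) := by
    rw [Finset.prod_univ_sum, Fintype.piFinset_univ, Matrix.mul_apply]
    refine Finset.sum_congr rfl fun c _ => ?_
    simp [pauliMatrix, Matrix.star_apply, Finset.prod_mul_distrib]
  rw [h2, Finset.prod_congr rfl fun q _ => h q, Matrix.one_apply]
  by_cases hb : b = b'
  · simp [hb]
  · obtain ⟨q, hq⟩ := Function.ne_iff.mp hb
    rw [if_neg hb]
    exact Finset.prod_eq_zero (Finset.mem_univ q) (if_neg hq)

/-- Unitary operators on `n` qubits. -/
abbrev QubitUnitary (n : ℕ) : Type := Matrix.unitaryGroup (Fin n → Fin 2) ℂ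

/-- The Pauli operator with phase `1`, as a unitary operator. -/
noncomputable def pauliOp {n : ℕ} (p : PauliBar (Fin n)) : QubitUnitary n :=
  ⟨pauliMatrix p, pauliMatrix_mem p⟩

/-- `P` is one of the operators `c • p` with a phase `c ∈ {1, -1, i, -i}`. -/
def IsPauliWithClass {n : ℕ} (P : QubitUnitary n) (p : PauliBar (Fin n)) : Prop :=
  ∃ k : ℕ, (P : Matrix (Fin n → Fin 2) (Fin n → Fin 2) ℂ) = Complex.I ^ k • pauliMatrix p

/-- The set of all `n`-qubit Pauli operators, with phases. -/
def pauliSet (n : ℕ) : Set (QubitUnitary n) := {P | ∃ p, IsPauliWithClass P p}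

open Classical in
/-- The class up to phase of a Pauli operator (only used for Pauli operators). -/
noncomputable def pauliClass {n : ℕ} (P : QubitUnitary n) : PauliBar (Fin n) :=
  if h : ∃ p, IsPauliWithClass P p then h.choose else 0

/-- Clifford unitaries: those whose conjugation action preserves the set of Pauli operators. -/
def IsClifford {n : ℕ} (U : QubitUnitary n) : Prop :=
  ∀ P : QubitUnitary n, U * P * U⁻¹ ∈ pauliSet n ↔ P ∈ pauliSet n

/-- Conjugation `p ↦ U⁻¹ p U` of Pauli operators up to phase. -/
noncomputable def conjInv {n : ℕ} (U : QubitUnitary n) (p : PauliBar (Fin n)) : PauliBar (Fin n) :=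
  pauliClass (U⁻¹ * pauliOp p * U)

/-- `U` acts on the qubits in `A` only: `U = u ⊗ I` with `u` acting on the qubits in `A`. -/
def ActsOn {n : ℕ} (U : QubitUnitary n) (A : Finset (Fin n)) : Prop :=
  ∃ u : Matrix (A → Fin 2) (A → Fin 2) ℂ, ∀ b b' : Fin n → Fin 2,
    (U : Matrix (Fin n → Fin 2) (Fin n → Fin 2) ℂ) b b' =
      if ∀ q, q ∉ A → b q = b' q then u (fun q => b q) (fun q => b' q) else 0

/-! ### Clifford circuits -/

/-- A Clifford unitary gate together with the set of qubits on which it acts. -/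
structure CliffordGate (n : ℕ) where
  toUnitary : QubitUnitary n
  qubits : Finset (Fin n)
  isClifford : IsClifford toUnitary
  actsOn : ActsOn toUnitary qubits

/-- A Hermitian Pauli operator `(-1)^sign • pauli`, to be measured. -/
structure MeasuredPauli (n : ℕ) where
  pauli : PauliBar (Fin n)
  sign : ZMod 2

/-- The measured operator as a unitary operator. -/
noncomputable def MeasuredPauli.op {n : ℕ} (S : MeasuredPauli n) : QubitUnitary n :=
  if S.sign = 0 then pauliOp S.pauli else -pauliOp S.pauli

/-- The projector `(I + (-1)^o S) / 2` associated with outcome `o` of the measurement of `S`. -/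
noncomputable def MeasuredPauli.projector {n : ℕ} (S : MeasuredPauli n) (o : ZMod 2) :
    Matrix (Fin n → Fin 2) (Fin n → Fin 2) ℂ :=
  (1 / 2 : ℂ) • (1 + (if o = 0 then (1 : ℂ) else -1) •
    (S.op : Matrix (Fin n → Fin 2) (Fin n → Fin 2) ℂ))

/-- A Clifford operation: a Clifford unitary gate or a Pauli measurement. -/
inductive CliffordOperation (n : ℕ) where
  | gate (g : CliffordGate n)
  | measure (S : MeasuredPauli n)

namespace CliffordOperation

variable {n : ℕ}

/-- The qubits on which the operation acts. -/
def qubits : CliffordOperation n → Finset (Fin n)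
  | gate g => g.qubits
  | measure S => S.pauli.support

/-- The operation is a measurement. -/
def IsMeasurement : CliffordOperation n → Prop
  | gate _ => False
  | measure _ => True

/-- The measured operator of a measurement. -/
def measured : (c : CliffordOperation n) → c.IsMeasurement → MeasuredPauli n
  | gate _, h => h.elim
  | measure S, _ => S

/-- The unitary of a gate; the identity for a measurement. -/
def unitaryPart : CliffordOperation n → QubitUnitary n
  | gate g => g.toUnitary
  | measure _ => 1

end CliffordOperation

/-- A Clifford circuit on `n` qubits: a sequence of Clifford operations in chronological order, each
with a level in `{1, 2, …}`, such that operations with the same level have disjoint supports. -/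
structure CliffordCircuit (n : ℕ) where
  size : ℕ
  op : Fin size → CliffordOperation n
  level : Fin size → ℕ
  level_pos : ∀ i, 1 ≤ level i
  level_mono : Monotone level
  disjoint : ∀ i j, i ≠ j → level i = level j → Disjoint (op i).qubits (op j).qubits

namespace CliffordCircuit

variable {n : ℕ} (C : CliffordCircuit n)

/-- The depth `Δ`: the maximum level of an operation (`0` for the empty circuit). -/
def depth : ℕ := Finset.univ.sup C.level

theorem level_le_depth (i : Fin C.size) : C.level i ≤ C.depth :=
  Finset.le_sup (f := C.level) (Finset.mem_univ i)

/-- The measurements of the circuit; this type plays the role of the index set `{1, …, m}`. -/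
abbrev Meas : Type := {i : Fin C.size // (C.op i).IsMeasurement}

noncomputable instance instFintypeMeas : Fintype C.Meas := Fintype.ofFinite _

/-- The measured operator `S_j`. -/
def measured (j : C.Meas) : MeasuredPauli n := (C.op j.1).measured j.2

/-! ### The outcome code -/

open Classical in
/-- The operator applied by the `i`-th operation when the measurement outcomes are `o`. -/
noncomputable def kraus (o : C.Meas → ZMod 2) (i : Fin C.size) :
    Matrix (Fin n → Fin 2) (Fin n → Fin 2) ℂ :=
  if h : (C.op i).IsMeasurement then (C.measured ⟨i, h⟩).projector (o ⟨i, h⟩)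
  else ((C.op i).unitaryPart : Matrix (Fin n → Fin 2) (Fin n → Fin 2) ℂ)

/-- The operator applied by the whole circuit (the first operation is the rightmost factor). -/
noncomputable def totalKraus (o : C.Meas → ZMod 2) : Matrix (Fin n → Fin 2) (Fin n → Fin 2) ℂ :=
  ((List.finRange C.size).reverse.map (C.kraus o)).prod

/-- The probability of the outcome bit-string `o` for the input state `ρ`. -/
noncomputable def outcomeProb (ρ : Matrix (Fin n → Fin 2) (Fin n → Fin 2) ℂ)
    (o : C.Meas → ZMod 2) : ℝ :=
  (Matrix.trace (C.totalKraus o * ρ * (C.totalKraus o).conjTranspose)).re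

open scoped ComplexOrder in
/-- The outcome code: outcome bit-strings of non-zero probability for some input density matrix. -/
def outcomeCode : Set (C.Meas → ZMod 2) :=
  {o | ∃ ρ : Matrix (Fin n → Fin 2) (Fin n → Fin 2) ℂ,
    ρ.PosSemidef ∧ ρ.trace = 1 ∧ C.outcomeProb ρ o ≠ 0}

/-- The outcome code is a linear code. -/
def HasLinearOutcomeCode : Prop :=
  ∃ W : Submodule (ZMod 2) (C.Meas → ZMod 2), (W : Set (C.Meas → ZMod 2)) = C.outcomeCode

/-- The dual of the outcome code. -/
def outcomeDual : Set (C.Meas → ZMod 2) := {u | ∀ o ∈ C.outcomeCode, ∑ j, u j * o j = 0}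

/-! ### The spacetime code -/

/-- The qubits supporting the fault operators; `(ℓ, q)` stands for the qubit `(ℓ + 0.5, q)`. -/
abbrev FaultQubit : Type := Fin (C.depth + 1) × Fin n

/-- The product `U_ℓ` of all unitary operations with level `ℓ`. -/
noncomputable def levelUnitary (ℓ : ℕ) : QubitUnitary n :=
  ((List.finRange C.size).reverse.map
    fun i => if C.level i = ℓ then (C.op i).unitaryPart else 1).prod

/-- The component `F_{ℓ + 0.5}` of a fault operator. -/
def slice (F : PauliBar C.FaultQubit) (ℓ : Fin (C.depth + 1)) : PauliBar (Fin n) :=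
  fun q => F (ℓ, q)

/-- The fault operator `η_{ℓ + 0.5}(P)`: `P` placed at level `ℓ + 0.5`. -/
def eta (ℓ : Fin (C.depth + 1)) (P : PauliBar (Fin n)) : PauliBar C.FaultQubit :=
  fun x => if x.1 = ℓ then P x.2 else 0

/-- The back-cumulant. For `ℓ = Δ, …, 1` the component at `ℓ + 0.5` is conjugated by `U_ℓ⁻¹` and
multiplied into the component at `ℓ - 0.5`; here `ℓ = k + 1`. -/
noncomputable def backCumulant (F : PauliBar C.FaultQubit) : PauliBar C.FaultQubit :=
  (List.finRange C.depth).reverse.foldl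
    (fun G (k : Fin C.depth) =>
      G + C.eta k.castSucc (conjInv (C.levelUnitary (k + 1)) (C.slice G k.succ))) F

/-- The position `ℓ_j - 0.5` right before the measurement of `S_j`. -/
def before (j : C.Meas) : Fin (C.depth + 1) :=
  ⟨C.level j.1 - 1, by have := C.level_le_depth j.1; omega⟩

/-- The fault operator `F(u)`, the product of the operators `η_{ℓ_j - 0.5}(S_j ^ u_j)`. -/
noncomputable def measFault (u : C.Meas → ZMod 2) : PauliBar C.FaultQubit :=
  ∑ j, C.eta (C.before j) (u j • (C.measured j).pauli)

/-- The check operator of `u`: the back-cumulant of `F(u)`. -/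
noncomputable def checkOperator (u : C.Meas → ZMod 2) : PauliBar C.FaultQubit :=
  C.backCumulant (C.measFault u)

/-- The stabilizers (up to phase) of the spacetime code: the check operators of the vectors of the
dual of the outcome code. -/
def stabilizers : Set (PauliBar C.FaultQubit) := C.checkOperator '' C.outcomeDual

/-! ### The spacetime graph -/

/-- The vertices `(ℓ + 0.5, q)` with `0 ≤ ℓ < Δ` of the spacetime graph. -/
abbrev Vertex : Type := Fin C.depth × Fin n

/-- A vertex of the spacetime graph as a qubit of the spacetime code. -/
def vertexQubit (v : C.Vertex) : C.FaultQubit := (v.1.castSucc, v.2)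

/-- The vertex `v` is of the form `(ℓ ± 0.5, q)` where `ℓ` is the level of the `i`-th operation and
`q` is a qubit on which this operation acts. -/
def Touches (i : Fin C.size) (v : C.Vertex) : Prop :=
  v.2 ∈ (C.op i).qubits ∧ ((v.1 : ℕ) + 1 = C.level i ∨ (v.1 : ℕ) = C.level i)

/-- The spacetime graph: each operation induces a clique. -/
def spacetimeGraph : SimpleGraph C.Vertex where
  Adj v w := v ≠ w ∧ ∃ i, C.Touches i v ∧ C.Touches i w
  symm := ⟨fun _ _ ⟨h, i, hv, hw⟩ => ⟨h.symm, i, hw, hv⟩⟩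
  loopless := ⟨fun _ h => h.1 rfl⟩

/-- The support of a fault operator in the spacetime graph. -/
def graphSupport (F : PauliBar C.FaultQubit) : Set C.Vertex := {v | F (C.vertexQubit v) ≠ 0}

/-- The support of `F` consists of vertices of the spacetime graph and is connected in this graph
(in particular it is not empty). -/
def HasConnectedSupport (F : PauliBar C.FaultQubit) : Prop :=
  (∀ x, F x ≠ 0 → ∃ v, C.vertexQubit v = x) ∧
    (C.spacetimeGraph.induce (C.graphSupport F)).Connected

/-! ### Computation of checks of the outcome code -/

/-- The state of the computation of the checks. `gens` is the current set of stabilizer generators,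
each with the indicator vector of the set of measurements it comes from; `checks` is the current set
of affine checks `∑_j w_j o_j = b`, stored as `(w, b)`. -/
structure CheckState where
  gens : List (QubitUnitary n × (C.Meas → ZMod 2))
  checks : List ((C.Meas → ZMod 2) × ZMod 2)

/-- The group generated by the current stabilizer generators. -/
def CheckState.group {C : CliffordCircuit n} (s : C.CheckState) : Subgroup (QubitUnitary n) :=
  Subgroup.closure {T | ∃ w, (T, w) ∈ s.gens}

open Classical in
/-- Processing one operation. The operator `T` and the decomposition `L` of `± S_j` as a product of
stabilizer generators are arbitrary. -/
inductive CheckStep : Fin C.size → C.CheckState → C.CheckState → Prop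
  /-- A unitary gate conjugates the generators. -/
  | gate (i : Fin C.size) (hi : ¬ (C.op i).IsMeasurement) (s : C.CheckState) :
      CheckStep i s
        ⟨s.gens.map fun T => ((C.op i).unitaryPart * T.1 * (C.op i).unitaryPart⁻¹, T.2), s.checks⟩
  /-- If `S_j` is in the group, the check `o_j + ∑_k o_k = 0` is added. -/
  | plus (j : C.Meas) (s : C.CheckState) (L : List (QubitUnitary n × (C.Meas → ZMod 2)))
      (hL : ∀ T ∈ L, T ∈ s.gens) (hprod : (L.map Prod.fst).prod = (C.measured j).op) :
      CheckStep j.1 s ⟨s.gens, s.checks ++ [(Pi.single j 1 + (L.map Prod.snd).sum, 0)]⟩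
  /-- If `-S_j` is in the group, the check `o_j + ∑_k o_k = 1` is added. -/
  | minus (j : C.Meas) (s : C.CheckState) (L : List (QubitUnitary n × (C.Meas → ZMod 2)))
      (hL : ∀ T ∈ L, T ∈ s.gens) (hprod : (L.map Prod.fst).prod = -(C.measured j).op) :
      CheckStep j.1 s ⟨s.gens, s.checks ++ [(Pi.single j 1 + (L.map Prod.snd).sum, 1)]⟩
  /-- If `± S_j` is not in the group and all generators commute with `S_j`, then `S_j` is added. -/
  | commuting (j : C.Meas) (s : C.CheckState)
      (hplus : (C.measured j).op ∉ s.group) (hminus : -(C.measured j).op ∉ s.group)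
      (hcomm : ∀ T ∈ s.gens, T.1 * (C.measured j).op ≠ -((C.measured j).op * T.1)) :
      CheckStep j.1 s ⟨s.gens ++ [((C.measured j).op, Pi.single j 1)], s.checks⟩
  /-- If `± S_j` is not in the group and `T` anticommutes with `S_j`, then the other anticommuting
  generators are multiplied by `T`, and `T` is replaced by `S_j`. -/
  | anticommuting (j : C.Meas) (s : C.CheckState)
      (hplus : (C.measured j).op ∉ s.group) (hminus : -(C.measured j).op ∉ s.group)
      (L₁ L₂ : List (QubitUnitary n × (C.Meas → ZMod 2))) (T : QubitUnitary n × (C.Meas → ZMod 2))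
      (hgens : s.gens = L₁ ++ T :: L₂)
      (hT : T.1 * (C.measured j).op = -((C.measured j).op * T.1)) :
      CheckStep j.1 s
        ⟨((L₁ ++ L₂).map fun T' =>
            if T'.1 * (C.measured j).op = -((C.measured j).op * T'.1) then
              (T.1 * T'.1, T.2 + T'.2) else T') ++ [((C.measured j).op, Pi.single j 1)],
          s.checks⟩

/-- Processing a list of operations one after the other. -/
inductive CheckSteps : List (Fin C.size) → C.CheckState → C.CheckState → Prop
  | nil (s : C.CheckState) : CheckSteps [] s s
  | cons (i : Fin C.size) (l : List (Fin C.size)) (s s' s'' : C.CheckState)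
      (hstep : C.CheckStep i s s') (hsteps : CheckSteps l s' s'') : CheckSteps (i :: l) s s''

/-- `R` is a possible output of the computation of checks of the outcome code. -/
def CheckRun (R : List ((C.Meas → ZMod 2) × ZMod 2)) : Prop :=
  ∃ s : C.CheckState, C.CheckSteps (List.finRange C.size) ⟨[], []⟩ s ∧ s.checks = R

end CliffordCircuit

/-! ### Restriction of a stabilizer group to a set of qubits -/

section Restriction

variable {Q : Type} [Fintype Q] [DecidableEq Q]

/-- `X i`, `Z i` (`i < K`) is a set of logical operators for the stabilizer code with generators `S`:
they satisfy the canonical commutation relations and, together with `S`, they generate the group of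
all Pauli operators that commute with `S`. -/
structure IsLogicalBasis (S : List (PauliBar Q)) {K : ℕ} (X Z : Fin K → PauliBar Q) : Prop where
  comm_X_Z : ∀ i j, (X i).comm (Z j) = if i = j then 1 else 0
  comm_X_X : ∀ i j, (X i).comm (X j) = 0
  comm_Z_Z : ∀ i j, (Z i).comm (Z j) = 0
  span_eq : ∀ P : PauliBar Q,
    P ∈ Submodule.span (ZMod 2) ({P | P ∈ S} ∪ Set.range X ∪ Set.range Z) ↔
      ∀ T ∈ S, P.comm T = 0

/-- The rows `G i` are in reduced row echelon form, without zero rows, for the ordering of the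
columns given by `ord`. -/
def IsRREF (ord : Q × Fin 2 → ℕ) {k : ℕ} (G : Fin k → PauliBar Q) : Prop :=
  ∃ piv : Fin k → Q × Fin 2, StrictMono (fun i => ord (piv i)) ∧
    ∀ i, (G i).entry (piv i) = 1 ∧
      (∀ c, ord c < ord (piv i) → (G i).entry c = 0) ∧
      ∀ j, j ≠ i → (G j).entry (piv i) = 0

/-- The inner loop: for each `j`, multiply the row by `H j` if it anticommutes with `G j`. -/
def reduceRow {k : ℕ} (G H : Fin k → PauliBar Q) (P : PauliBar Q) : PauliBar Q :=
  (List.finRange k).foldl (fun s j => if s.comm (G j) = 1 then s + H j else s) P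

/-- `out` is a possible output of the computation of generators for the restriction to `A` of the
stabilizer group with generators `S` and logical operators `X`, `Z`. The row echelon form `G` of the
matrix of non-trivial restricted operators (for any ordering of the columns) and the matrix `H`,
supported on `A`, with `[H i, G j] = δ_{i j}` are arbitrary. -/
def RestrictedRun (S : List (PauliBar Q)) {K : ℕ} (X Z : Fin K → PauliBar Q) (A : Finset Q)
    (out : Set (PauliBar Q)) : Prop :=
  ∃ (ord : Q × Fin 2 → ℕ) (k : ℕ) (G H : Fin k → PauliBar Q),
    Function.Injective ord ∧
    IsRREF ord G ∧
    Submodule.span (ZMod 2) (Set.range G) =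
      Submodule.span (ZMod 2)
        {P | P ∈ ((S ++ List.ofFn X ++ List.ofFn Z).map (PauliBar.restrict A)).filter (· ≠ 0)} ∧
    (∀ i, (H i).support ⊆ A) ∧
    (∀ i j, (H i).comm (G j) = if i = j then 1 else 0) ∧
    out = {P | ∃ q ∈ A, P = reduceRow G H (Pi.single q (1, 0)) ∨
      P = reduceRow G H (Pi.single q (0, 1))}

end Restriction

/-! ### Low-weight stabilizers of the spacetime code -/

namespace CliffordCircuit

variable {n : ℕ} (C : CliffordCircuit n)

open Classical in
/-- The qubits of the vertices at distance at most `r` from `v` in the spacetime graph. -/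
noncomputable def ballQubits (v : C.Vertex) (r : ℕ) : Finset C.FaultQubit :=
  (Finset.univ.filter fun w => C.spacetimeGraph.edist v w ≤ (r : ℕ∞)).image C.vertexQubit

/-- `out` is a possible output of the search for low-weight stabilizers: compute checks of the
outcome code, the corresponding stabilizer generators, and logical operators; for each vertex `v`,
compute generators `SA v` of the restriction to the ball with radius `⌊M/2⌋` around `v`; keep the
operators generated by `SA v` with weight at most `M` whose support has a single connected
component. -/
def LowWeightRun (M : ℕ) (out : Set (PauliBar C.FaultQubit)) : Prop :=
  ∃ (R : List ((C.Meas → ZMod 2) × ZMod 2)) (K : ℕ) (X Z : Fin K → PauliBar C.FaultQubit)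
    (SA : C.Vertex → Set (PauliBar C.FaultQubit)),
    C.CheckRun R ∧
    IsLogicalBasis (R.map fun c => C.checkOperator c.1) X Z ∧
    (∀ v, RestrictedRun (R.map fun c => C.checkOperator c.1) X Z (C.ballQubits v (M / 2)) (SA v)) ∧
    out = {F | ∃ v, F ∈ Submodule.span (ZMod 2) (SA v) ∧ F.weight ≤ M ∧
      Nat.card (C.spacetimeGraph.induce (C.graphSupport F)).ConnectedComponent = 1}

end CliffordCircuit

set_option linter.unusedSectionVars false

/-! ### Symplectic linear algebra of Pauli operators up to phase -/

/-! The proof has four independent ingredients: the checks found by stabilizer simulation, the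
commutation of their check operators, the restriction to a set `A`, and the radius of the balls.

Checks. Let `K o` be the product of the operators applied for outcomes `o`. By induction along the
circuit, `K o * (K o)ᴴ` is zero if `o` violates a check found so far, and otherwise a non-zero
multiple of `stabProd o gens`, the product of the factors `1 + (-1)^(w ⬝ o) T` over the current
generators (`CheckStep.describes`). The trace of `stabProd` never vanishes, so the outcome code is
exactly the solution set of the affine checks. If it is linear it contains `0`, all constants are
`0`, and the vectors of the checks span the dual code (`CheckRun.outcomeDual_eq_span`). As
`checkOperator` is linear in its vector, the set `𝒮` generates the stabilizers
(`CheckRun.stabilizers_eq_span`).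

Commutation. Logical operators exist only if the elements of `𝒮` commute. Let `accum t w` be the
product of the measured operators selected by `w` among the first `t` operations, propagated forward
to time `t`. Generators of the simulation have class `accum t w`, and checks have `accum t w = 0`.
For a vector whose accumulated operator is trivial at the end of the circuit, propagating the later
measurements backward gives the same operator as propagating the earlier ones forward, so each slice
of the check operator is some `accum t u` (`slice_checkOperator`). The simulation also maintains
that all its vectors have commuting accumulated operators at every past time (`CheckStep.valid`),
hence the check operators commute slice by slice.

Restriction. The symplectic form is non-degenerate, so `F` lies in the span of `𝒮` if and only if it
commutes with every operator that commutes with `𝒮`, that is, with `𝒮` and the logical operators.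
For `F` supported on `A` only their restrictions to `A` matter, hence only the rows `G j`. The map
`P ↦ P + ∑ j, [P, G j] H j` is a projection of the operators on `A` onto those commuting with all `G
j`, so the images of the single-qubit operators generate the stabilizers supported on `A`
(`RestrictedRun.mem_span_iff`). The required choices exist by `exists_isRREF` and
`exists_symplectic_basis`.

Balls. A connected graph with at most `M` vertices has radius at most `⌊M/2⌋`
(`SimpleGraph.exists_center`), so every connected stabilizer of weight at most `M` lies in one of
the balls. Conversely, an operator supported on a ball is trivial at level `Δ + 0.5`, so having one
component is the same as being connected in the required sense. -/

theorem ZMod.eq_zero_or_eq_one (a : ZMod 2) : a = 0 ∨ a = 1 := by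
  revert a; decide

/-- A vector annihilated by all linear functionals that vanish on `s` lies in the span of `s`. -/
theorem mem_span_of_forall_functional {V : Type*} [AddCommGroup V] [Module (ZMod 2) V] {s : Set V}
    {v : V} (h : ∀ f : V →ₗ[ZMod 2] ZMod 2, (∀ x ∈ s, f x = 0) → f v = 0) :
    v ∈ Submodule.span (ZMod 2) s := by
  by_contra hv
  obtain ⟨f, hfv, hf⟩ := Submodule.exists_le_ker_of_notMem hv
  exact hfv (h f fun x hx => hf (Submodule.subset_span hx))

namespace PauliBar

variable {Q : Type} [Fintype Q] [DecidableEq Q]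

theorem comm_add_left (P P' R : PauliBar Q) : (P + P').comm R = P.comm R + P'.comm R := by
  simp only [comm, Pi.add_apply, Prod.fst_add, Prod.snd_add, ← Finset.sum_add_distrib]
  exact Finset.sum_congr rfl fun q _ => by ring

theorem comm_smul_left (a : ZMod 2) (P R : PauliBar Q) : (a • P).comm R = a * P.comm R := by
  simp only [comm, Pi.smul_apply, Prod.smul_fst, Prod.smul_snd, smul_eq_mul, Finset.mul_sum]
  exact Finset.sum_congr rfl fun q _ => by ring

theorem comm_symm (P R : PauliBar Q) : P.comm R = R.comm P :=
  Finset.sum_congr rfl fun q _ => by ring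

theorem comm_self (P : PauliBar Q) : P.comm P = 0 :=
  Finset.sum_eq_zero fun q _ => by
    rw [mul_comm]; exact CharTwo.add_self_eq_zero _

/-- The commutator with `R` as a linear functional. -/
def commWith (R : PauliBar Q) : PauliBar Q →ₗ[ZMod 2] ZMod 2 where
  toFun P := P.comm R
  map_add' P P' := comm_add_left P P' R
  map_smul' a P := comm_smul_left a P R

@[simp]
theorem commWith_apply (R P : PauliBar Q) : commWith R P = P.comm R := rfl

theorem comm_zero_left (R : PauliBar Q) : (0 : PauliBar Q).comm R = 0 := map_zero (commWith R)

theorem comm_eq_zero_of_mem_span {s : Set (PauliBar Q)} {R P : PauliBar Q}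
    (h : ∀ x ∈ s, x.comm R = 0) (hP : P ∈ Submodule.span (ZMod 2) s) : P.comm R = 0 := by
  have : Submodule.span (ZMod 2) s ≤ LinearMap.ker (commWith R) :=
    Submodule.span_le.2 fun x hx => h x hx
  exact this hP

theorem comm_single_X (P : PauliBar Q) (q : Q) : P.comm (Pi.single q (1, 0)) = (P q).2 := by
  rw [comm, Finset.sum_eq_single q]
  · simp
  · intro b _ hb; simp [Pi.single_eq_of_ne hb]
  · simp

theorem comm_single_Z (P : PauliBar Q) (q : Q) : P.comm (Pi.single q (0, 1)) = (P q).1 := by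
  rw [comm, Finset.sum_eq_single q]
  · simp
  · intro b _ hb; simp [Pi.single_eq_of_ne hb]
  · simp

theorem eq_sum_single (P : PauliBar Q) :
    P = ∑ q, ((P q).1 • (Pi.single q (1, 0) : PauliBar Q) +
      (P q).2 • (Pi.single q (0, 1) : PauliBar Q)) := by
  ext q
  · simp [Finset.sum_apply, Pi.single_apply, apply_ite Prod.fst, Prod.fst_sum]
  · simp [Finset.sum_apply, Pi.single_apply, apply_ite Prod.snd, Prod.snd_sum]

/-- Every linear functional is the commutator with some Pauli operator. -/
theorem exists_commWith_eq (f : PauliBar Q →ₗ[ZMod 2] ZMod 2) : ∃ R, f = commWith R := by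
  refine ⟨fun q => (f (Pi.single q (0, 1)), f (Pi.single q (1, 0))), LinearMap.ext fun P => ?_⟩
  conv_lhs => rw [eq_sum_single P]
  simp only [map_sum, map_add, map_smul, smul_eq_mul, commWith_apply, comm]

/-- The double commutant of a set of Pauli operators is its span. -/
theorem mem_span_of_forall_comm {s : Set (PauliBar Q)} {P : PauliBar Q}
    (h : ∀ R, (∀ x ∈ s, x.comm R = 0) → P.comm R = 0) : P ∈ Submodule.span (ZMod 2) s := by
  refine mem_span_of_forall_functional fun f hf => ?_
  obtain ⟨R, rfl⟩ := exists_commWith_eq f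
  exact h R hf

/-! ### Restriction and support -/

theorem mem_support {P : PauliBar Q} {q : Q} : q ∈ P.support ↔ P q ≠ 0 := by
  simp [support]

theorem support_subset_iff {P : PauliBar Q} {A : Finset Q} :
    P.support ⊆ A ↔ ∀ q, q ∉ A → P q = 0 := by
  simp only [Finset.subset_iff, mem_support]
  exact forall_congr' fun q => not_imp_comm

/-- The operators supported on `A`. -/
def supportedOn (A : Finset Q) : Submodule (ZMod 2) (PauliBar Q) where
  carrier := {P | ∀ q, q ∉ A → P q = 0}
  add_mem' hP hR q hq := by simp [hP q hq, hR q hq]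
  zero_mem' _ _ := rfl
  smul_mem' a P hP q hq := by simp [hP q hq]

theorem restrict_mem_supportedOn (A : Finset Q) (P : PauliBar Q) :
    P.restrict A ∈ supportedOn A := fun q hq => by simp [restrict, hq]

theorem comm_restrict {A : Finset Q} {F : PauliBar Q} (hF : F ∈ supportedOn A) (P : PauliBar Q) :
    (P.restrict A).comm F = P.comm F := by
  refine Finset.sum_congr rfl fun q _ => ?_
  by_cases hq : q ∈ A
  · simp [restrict, hq]
  · simp [restrict, hq, hF q hq]

theorem supportedOn_eq_span (A : Finset Q) :
    supportedOn A = Submodule.span (ZMod 2)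
      {P | ∃ q ∈ A, P = Pi.single q (1, 0) ∨ P = Pi.single q (0, 1)} := by
  apply le_antisymm
  · intro P hP
    rw [eq_sum_single P]
    refine Submodule.sum_mem _ fun q _ => ?_
    by_cases hq : q ∈ A
    · exact Submodule.add_mem _
        (Submodule.smul_mem _ _ (Submodule.subset_span ⟨q, hq, Or.inl rfl⟩))
        (Submodule.smul_mem _ _ (Submodule.subset_span ⟨q, hq, Or.inr rfl⟩))
    · simp [hP q hq]
  · rw [Submodule.span_le]
    rintro P ⟨q, hq, rfl | rfl⟩ b hb <;>
      exact Pi.single_eq_of_ne (fun h : b = q => hb (h ▸ hq)) _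

/-! ### Reduced row echelon forms -/

/-- The entry in a column as a linear functional. -/
def entryHom (c : Q × Fin 2) : PauliBar Q →ₗ[ZMod 2] ZMod 2 where
  toFun P := P.entry c
  map_add' P P' := by simp only [entry]; split_ifs <;> simp
  map_smul' a P := by simp only [entry]; split_ifs <;> simp

@[simp]
theorem entryHom_apply (c : Q × Fin 2) (P : PauliBar Q) : entryHom c P = P.entry c := rfl

theorem exists_entry_ne_zero {P : PauliBar Q} (hP : P ≠ 0) : ∃ c, P.entry c ≠ 0 := by
  by_contra! h
  refine hP (funext fun q => Prod.ext ?_ ?_)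
  · simpa [entry] using h (q, 0)
  · simpa [entry] using h (q, 1)

/-- Induction on the dimension: the first column on which `W` does not vanish is the first pivot,
the rows vanishing there form a smaller space `W'`, and one further row of `W`, cleared in the pivot
columns of `W'`, completes its echelon form. -/
theorem exists_isRREF (ord : Q × Fin 2 → ℕ) (hord : Function.Injective ord)
    (W : Submodule (ZMod 2) (PauliBar Q)) :
    ∃ (k : ℕ) (G : Fin k → PauliBar Q), IsRREF ord G ∧
      Submodule.span (ZMod 2) (Set.range G) = W := by
  induction hd : Module.finrank (ZMod 2) W using Nat.strong_induction_on generalizing W with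
  | _ d ih =>
  by_cases hW : W = ⊥
  · subst hW
    refine ⟨0, Fin.elim0, ⟨Fin.elim0, fun i => i.elim0, fun i => i.elim0⟩, ?_⟩
    simp
  classical
  obtain ⟨w₀, hw₀, hw₀0⟩ := (Submodule.ne_bot_iff W).1 hW
  obtain ⟨c₀, hc₀⟩ := exists_entry_ne_zero hw₀0
  obtain ⟨c, hc, hmin⟩ := Finset.exists_min_image
    (Finset.univ.filter fun c : Q × Fin 2 => ∃ w ∈ W, w.entry c ≠ 0) ord
    ⟨c₀, by simpa using ⟨w₀, hw₀, hc₀⟩⟩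
  simp only [Finset.mem_filter, Finset.mem_univ, true_and] at hc hmin
  obtain ⟨w, hwW, hwc⟩ := hc
  replace hwc : w.entry c = 1 := (ZMod.eq_zero_or_eq_one _).resolve_left hwc
  have hzero : ∀ x ∈ W, ∀ c', ord c' < ord c → x.entry c' = 0 := by
    intro x hx c' hc'
    by_contra hne
    exact absurd (hmin c' ⟨x, hx, hne⟩) (not_le.2 hc')
  set W' := W ⊓ LinearMap.ker (entryHom c) with hW'
  have hlt : W' < W := by
    refine lt_of_le_of_ne inf_le_left fun h => ?_
    have : w ∈ W' := h ▸ hwW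
    have h0 : w.entry c = 0 := this.2
    rw [h0] at hwc
    exact zero_ne_one hwc
  obtain ⟨k, G, ⟨piv, hpiv, hG⟩, hspan⟩ :=
    ih _ (hd ▸ Submodule.finrank_lt_finrank_of_lt hlt) W' rfl
  have hGW' : ∀ i, G i ∈ W' := fun i => hspan ▸ Submodule.subset_span ⟨i, rfl⟩
  have hGc : ∀ i, (G i).entry c = 0 := fun i => (hGW' i).2
  -- Over `ZMod 2`, adding row `G i` whenever `w` has entry `1` in its pivot column clears that
  -- column.
  set w' := w + ∑ i, w.entry (piv i) • G i with hw'
  have hw'W : w' ∈ W :=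
    W.add_mem hwW (W.sum_mem fun i _ => W.smul_mem _ (hGW' i).1)
  have hw'entry : ∀ c', w'.entry c' = w.entry c' + ∑ i, w.entry (piv i) * (G i).entry c' := by
    intro c'
    have := congrArg (entryHom c') hw'
    simpa only [map_add, map_sum, map_smul, smul_eq_mul, entryHom_apply] using this
  have hw'c : w'.entry c = 1 := by simp [hw'entry, hwc, hGc]
  refine ⟨k + 1, Fin.cons w' G, ⟨Fin.cons c piv, ?_, ?_⟩, ?_⟩
  -- Minimality of `c` gives `≤`; equality is impossible because all rows of `G` vanish in column
  -- `c`.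
  · have h0 : ∀ i, ord c < ord (piv i) := by
      intro i
      refine lt_of_le_of_ne (hmin _ ⟨G i, (hGW' i).1, by simp [(hG i).1]⟩) fun h => ?_
      have h1 := (hG i).1
      rw [← hord h, hGc] at h1
      exact zero_ne_one h1
    intro i j hij
    induction j using Fin.cases with
    | zero => exact absurd hij (Fin.not_lt_zero i)
    | succ j =>
      induction i using Fin.cases with
      | zero => simpa using h0 j
      | succ i => simpa using hpiv (Fin.succ_lt_succ_iff.1 hij)
  · intro i
    induction i using Fin.cases with
    | zero =>
      refine ⟨by simpa using hw'c, fun c' hc' => by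
        simpa using hzero w' hw'W c' (by simpa using hc'), fun j hj => ?_⟩
      induction j using Fin.cases with
      | zero => exact absurd rfl hj
      | succ j => simpa using hGc j
    | succ i =>
      refine ⟨by simpa using (hG i).1, fun c' hc' => by
        simpa using (hG i).2.1 c' (by simpa using hc'), fun j hj => ?_⟩
      induction j using Fin.cases with
      | zero =>
        simp only [Fin.cons_zero, Fin.cons_succ, hw'entry]
        rw [Finset.sum_eq_single i, (hG i).1, mul_one]
        · exact CharTwo.add_self_eq_zero _
        · intro j _ hj; rw [(hG i).2.2 j hj, mul_zero]
        · simp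
      | succ j => simpa using (hG i).2.2 j fun h => hj (congrArg _ h)
  · apply le_antisymm
    · rw [Submodule.span_le]
      rintro _ ⟨i, rfl⟩
      induction i using Fin.cases with
      | zero => simpa using hw'W
      | succ i => simpa using (hGW' i).1
    · have hsub : W' ≤
          Submodule.span (ZMod 2) (Set.range (Fin.cons w' G : Fin (k + 1) → PauliBar Q)) := by
        rw [← hspan]
        refine Submodule.span_mono ?_
        rintro _ ⟨i, rfl⟩
        exact ⟨i.succ, by simp⟩
      have hmem : w' ∈ Submodule.span (ZMod 2)
          (Set.range (Fin.cons w' G : Fin (k + 1) → PauliBar Q)) :=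
        Submodule.subset_span ⟨0, by simp⟩
      intro x hx
      rcases ZMod.eq_zero_or_eq_one (x.entry c) with h | h
      · exact hsub ⟨hx, h⟩
      · have : x - w' ∈ W' := by
          refine ⟨W.sub_mem hx hw'W, ?_⟩
          change entryHom c (x - w') = 0
          rw [map_sub, entryHom_apply, entryHom_apply, h, hw'c, sub_self]
        simpa using Submodule.add_mem _ (hsub this) hmem

/-! ### Symplectic bases -/

/-- Symplectic Gram–Schmidt: as long as `N` is not isotropic, split off a hyperbolic pair `x`, `z`
and continue in its commutant inside `N`. The hypotheses make `V` the radical of `N`, and it remains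
the radical of each smaller space, so it is what is left when the process stops. -/
theorem exists_symplectic_basis (V N : Submodule (ZMod 2) (PauliBar Q)) (hVN : V ≤ N)
    (hV : ∀ p ∈ V, ∀ q ∈ N, p.comm q = 0) (hrad : ∀ p ∈ N, (∀ q ∈ N, p.comm q = 0) → p ∈ V) :
    ∃ (K : ℕ) (X Z : Fin K → PauliBar Q),
      (∀ i j, (X i).comm (Z j) = if i = j then 1 else 0) ∧
      (∀ i j, (X i).comm (X j) = 0) ∧ (∀ i j, (Z i).comm (Z j) = 0) ∧
      V ⊔ Submodule.span (ZMod 2) (Set.range X ∪ Set.range Z) = N := by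
  induction hd : Module.finrank (ZMod 2) N using Nat.strong_induction_on generalizing N with
  | _ d ih =>
  by_cases hN : ∀ p ∈ N, ∀ q ∈ N, p.comm q = 0
  · refine ⟨0, Fin.elim0, Fin.elim0, fun i => i.elim0, fun i => i.elim0, fun i => i.elim0, ?_⟩
    have : N = V := le_antisymm (fun p hp => hrad p hp (hN p hp)) hVN
    simp [this]
  push Not at hN
  obtain ⟨x, hx, z, hz, hxz⟩ := hN
  replace hxz : x.comm z = 1 := (ZMod.eq_zero_or_eq_one _).resolve_left hxz
  have hzx : z.comm x = 1 := by rw [comm_symm, hxz]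
  set N' := N ⊓ (LinearMap.ker (commWith x) ⊓ LinearMap.ker (commWith z)) with hN'
  have hmem : ∀ p, p ∈ N' ↔ p ∈ N ∧ p.comm x = 0 ∧ p.comm z = 0 := fun p => Iff.rfl
  have hlt : N' < N := by
    refine lt_of_le_of_ne inf_le_left fun h => ?_
    have h0 : x ∈ N' := h ▸ hx
    have h1 := ((hmem x).1 h0).2.2
    rw [hxz] at h1
    exact one_ne_zero h1
  -- The projection of `N` onto the commutant of the pair; there are no signs in characteristic 2.
  have hdecomp : ∀ p ∈ N, p + (p.comm z • x + p.comm x • z) ∈ N' := by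
    intro p hp
    refine (hmem _).2 ⟨N.add_mem hp (N.add_mem (N.smul_mem _ hx) (N.smul_mem _ hz)), ?_, ?_⟩
    · simp only [comm_add_left, comm_smul_left, comm_self, hzx, mul_zero, mul_one, zero_add]
      exact CharTwo.add_self_eq_zero _
    · simp only [comm_add_left, comm_smul_left, comm_self, hxz, mul_zero, mul_one, add_zero]
      exact CharTwo.add_self_eq_zero _
  obtain ⟨K, X, Z, hXZ, hXX, hZZ, hspan⟩ := ih _ (hd ▸ Submodule.finrank_lt_finrank_of_lt hlt) N'
    (fun p hp => (hmem p).2 ⟨hVN hp, hV p hp x hx, hV p hp z hz⟩)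
    (fun p hp q hq => hV p hp q ((hmem q).1 hq).1)
    -- An element `q` of `N` differs from its projection to `N'` by a combination of `x` and `z`,
    -- and `p` commutes with both parts.
    (fun p hp h => by
      obtain ⟨hpN, hpx, hpz⟩ := (hmem p).1 hp
      refine hrad p hpN fun q hq => ?_
      have h1 := h _ (hdecomp q hq)
      rw [comm_symm, comm_add_left, comm_add_left, comm_smul_left, comm_smul_left,
        comm_symm x, comm_symm z, hpx, hpz, mul_zero, mul_zero, add_zero, add_zero] at h1
      rw [comm_symm, h1]) rfl
  have hXN : ∀ i, X i ∈ N' := fun i => hspan ▸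
    Submodule.mem_sup_right (Submodule.subset_span (Or.inl ⟨i, rfl⟩))
  have hZN : ∀ i, Z i ∈ N' := fun i => hspan ▸
    Submodule.mem_sup_right (Submodule.subset_span (Or.inr ⟨i, rfl⟩))
  refine ⟨K + 1, Fin.cons x X, Fin.cons z Z, ?_, ?_, ?_, ?_⟩
  · intro i j
    induction i using Fin.cases with
    | zero =>
      induction j using Fin.cases with
      | zero => simpa using hxz
      | succ j => simpa [comm_symm x, (Fin.succ_ne_zero j).symm] using ((hmem _).1 (hZN j)).2.1
    | succ i =>
      induction j using Fin.cases with
      | zero => simpa using ((hmem _).1 (hXN i)).2.2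
      | succ j => simpa using hXZ i j
  · intro i j
    induction i using Fin.cases with
    | zero =>
      induction j using Fin.cases with
      | zero => simpa using comm_self x
      | succ j => simpa [comm_symm x] using ((hmem _).1 (hXN j)).2.1
    | succ i =>
      induction j using Fin.cases with
      | zero => simpa using ((hmem _).1 (hXN i)).2.1
      | succ j => simpa using hXX i j
  · intro i j
    induction i using Fin.cases with
    | zero =>
      induction j using Fin.cases with
      | zero => simpa using comm_self z
      | succ j => simpa [comm_symm z] using ((hmem _).1 (hZN j)).2.2
    | succ i =>
      induction j using Fin.cases with
      | zero => simpa using ((hmem _).1 (hZN i)).2.2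
      | succ j => simpa using hZZ i j
  · set X' : Fin (K + 1) → PauliBar Q := Fin.cons x X
    set Z' : Fin (K + 1) → PauliBar Q := Fin.cons z Z
    apply le_antisymm
    · refine sup_le hVN (Submodule.span_le.2 ?_)
      rintro _ (⟨i, rfl⟩ | ⟨i, rfl⟩) <;> induction i using Fin.cases with
      | zero => assumption
      | succ i => first | exact ((hmem _).1 (hXN i)).1 | exact ((hmem _).1 (hZN i)).1
    · have hle : N' ≤ V ⊔ Submodule.span (ZMod 2) (Set.range X' ∪ Set.range Z') := by
        rw [← hspan]
        refine sup_le_sup_left (Submodule.span_mono (Set.union_subset_union ?_ ?_)) _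
        · rintro _ ⟨i, rfl⟩; exact ⟨i.succ, rfl⟩
        · rintro _ ⟨i, rfl⟩; exact ⟨i.succ, rfl⟩
      have hx' : x ∈ V ⊔ Submodule.span (ZMod 2) (Set.range X' ∪ Set.range Z') :=
        Submodule.mem_sup_right (Submodule.subset_span (Or.inl ⟨0, rfl⟩))
      have hz' : z ∈ V ⊔ Submodule.span (ZMod 2) (Set.range X' ∪ Set.range Z') :=
        Submodule.mem_sup_right (Submodule.subset_span (Or.inr ⟨0, rfl⟩))
      intro p hp
      have h := Submodule.sub_mem _ (hle (hdecomp p hp)) (Submodule.add_mem _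
        (Submodule.smul_mem _ (p.comm z) hx') (Submodule.smul_mem _ (p.comm x) hz'))
      simpa using h

end PauliBar

/-! ### Existence of logical operators and correctness of the restriction algorithm -/

section Restriction

variable {Q : Type} [Fintype Q] [DecidableEq Q]

open PauliBar

theorem exists_isLogicalBasis (S : List (PauliBar Q)) (hS : ∀ P ∈ S, ∀ R ∈ S, P.comm R = 0) :
    ∃ (K : ℕ) (X Z : Fin K → PauliBar Q), IsLogicalBasis S X Z := by
  set V := Submodule.span (ZMod 2) {P | P ∈ S} with hV
  let N : Submodule (ZMod 2) (PauliBar Q) :=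
    { carrier := {P | ∀ T ∈ S, P.comm T = 0}
      add_mem' := fun hP hR T hT => by rw [comm_add_left, hP T hT, hR T hT, add_zero]
      zero_mem' := fun T _ => comm_zero_left T
      smul_mem' := fun a P hP T hT => by rw [comm_smul_left, hP T hT, mul_zero] }
  have hN : ∀ P, P ∈ N ↔ ∀ T ∈ S, P.comm T = 0 := fun P => Iff.rfl
  obtain ⟨K, X, Z, hXZ, hXX, hZZ, hspan⟩ := exists_symplectic_basis V N
    (Submodule.span_le.2 fun P hP => (hN P).2 (hS P hP))
    (fun p hp q hq => comm_eq_zero_of_mem_span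
      (fun x hx => by rw [comm_symm]; exact (hN q).1 hq x hx) hp)
    -- Any `R` that commutes with `S` belongs to `N`, so an element of the radical of `N` lies in
    -- the double commutant of `S`, which is its span.
    (fun p hp h => mem_span_of_forall_comm fun R hR =>
      h R ((hN R).2 fun T hT => by rw [comm_symm]; exact hR T hT))
  refine ⟨K, X, Z, hXZ, hXX, hZZ, fun P => ?_⟩
  rw [Set.union_assoc, Submodule.span_union, ← hV, hspan, hN]

/-! ### The restriction algorithm -/

/-- Multiplication by those `H j` for which `G j` anticommutes with the operator. -/
def reduceHom {k : ℕ} (G H : Fin k → PauliBar Q) : PauliBar Q →ₗ[ZMod 2] PauliBar Q :=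
  LinearMap.id + ∑ j, (commWith (G j)).smulRight (H j)

theorem reduceHom_apply {k : ℕ} (G H : Fin k → PauliBar Q) (P : PauliBar Q) :
    reduceHom G H P = P + ∑ j, P.comm (G j) • H j := by
  simp [reduceHom]

/-- Multiplying by `H i` does not change the commutators with the `G j` for `j ≠ i`, so each test
can be made on the original operator. This needs every index to occur only once. -/
theorem foldl_reduce {k : ℕ} (G H : Fin k → PauliBar Q)
    (hGH : ∀ i j, (H i).comm (G j) = if i = j then 1 else 0) (l : List (Fin k)) (hl : l.Nodup)
    (P : PauliBar Q) :
    l.foldl (fun s j => if s.comm (G j) = 1 then s + H j else s) P =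
      P + (l.map fun j => P.comm (G j) • H j).sum := by
  induction l generalizing P with
  | nil => simp
  | cons i l ih =>
    obtain ⟨hi, hl⟩ := List.nodup_cons.1 hl
    have hstep : (if P.comm (G i) = 1 then P + H i else P) = P + P.comm (G i) • H i := by
      rcases ZMod.eq_zero_or_eq_one (P.comm (G i)) with h | h <;> simp [h]
    rw [List.foldl_cons, hstep, ih hl, List.map_cons, List.sum_cons, add_assoc]
    congr 3
    refine List.map_congr_left fun j hj => ?_
    rw [comm_add_left, comm_smul_left, hGH, if_neg (fun h : i = j => hi (h ▸ hj)), mul_zero,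
      add_zero]

theorem reduceRow_eq {k : ℕ} {G H : Fin k → PauliBar Q}
    (hGH : ∀ i j, (H i).comm (G j) = if i = j then 1 else 0) (P : PauliBar Q) :
    reduceRow G H P = reduceHom G H P := by
  rw [reduceRow, foldl_reduce G H hGH _ (List.nodup_finRange k), reduceHom_apply]
  congr 1

theorem reduceHom_comm {k : ℕ} {G H : Fin k → PauliBar Q}
    (hGH : ∀ i j, (H i).comm (G j) = if i = j then 1 else 0) (P : PauliBar Q) (j : Fin k) :
    (reduceHom G H P).comm (G j) = 0 := by
  have h : (∑ i, P.comm (G i) • H i).comm (G j) = P.comm (G j) := by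
    rw [← commWith_apply, map_sum]
    simp [hGH]
  rw [reduceHom_apply, comm_add_left, h]
  exact CharTwo.add_self_eq_zero _

/-- The restriction algorithm computes generators of the subgroup of the stabilizers that are
supported on `A`. -/
theorem RestrictedRun.mem_span_iff {S : List (PauliBar Q)} {K : ℕ} {X Z : Fin K → PauliBar Q}
    {A : Finset Q} {out : Set (PauliBar Q)} (hL : IsLogicalBasis S X Z)
    (h : RestrictedRun S X Z A out) (F : PauliBar Q) :
    F ∈ Submodule.span (ZMod 2) out ↔
      F ∈ Submodule.span (ZMod 2) {P | P ∈ S} ∧ F ∈ supportedOn A := by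
  obtain ⟨ord, k, G, H, -, -, hspan, hHA, hGH, rfl⟩ := h
  have hout : {P | ∃ q ∈ A, P = reduceRow G H (Pi.single q (1, 0)) ∨
      P = reduceRow G H (Pi.single q (0, 1))} = reduceHom G H ''
        {P | ∃ q ∈ A, P = Pi.single q (1, 0) ∨ P = Pi.single q (0, 1)} := by
    ext P
    constructor
    · rintro ⟨q, hq, rfl | rfl⟩
      · exact ⟨_, ⟨q, hq, Or.inl rfl⟩, (reduceRow_eq hGH _).symm⟩
      · exact ⟨_, ⟨q, hq, Or.inr rfl⟩, (reduceRow_eq hGH _).symm⟩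
    · rintro ⟨_, ⟨q, hq, rfl | rfl⟩, rfl⟩
      · exact ⟨q, hq, Or.inl (reduceRow_eq hGH _).symm⟩
      · exact ⟨q, hq, Or.inr (reduceRow_eq hGH _).symm⟩
  rw [hout, Submodule.span_image, ← supportedOn_eq_span, Submodule.mem_map]
  -- On operators supported on `A`, the rows of `G` detect commutation with all generators and
  -- logical operators; the double commutant then identifies the operators commuting with `G` as the
  -- stabilizers.
  have hG : F ∈ supportedOn A → ((∀ j, F.comm (G j) = 0) ↔
      F ∈ Submodule.span (ZMod 2) {P | P ∈ S}) := by
    intro hF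
    constructor
    · intro hFG
      have hall : ∀ P ∈ {P | P ∈ S} ∪ Set.range X ∪ Set.range Z, P.comm F = 0 := by
        intro P hP
        rw [← comm_restrict hF]
        -- The trivial restrictions, which were dropped from the matrix, impose no condition.
        by_cases h0 : P.restrict A = 0
        · rw [h0, comm_zero_left]
        refine comm_eq_zero_of_mem_span (s := Set.range G) ?_ ?_
        · rintro _ ⟨j, rfl⟩
          rw [comm_symm, hFG]
        · rw [hspan]
          refine Submodule.subset_span ?_
          simp only [Set.mem_ofPred_eq, List.mem_filter, List.mem_map, List.mem_append,
            List.mem_ofFn, decide_eq_true_eq]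
          exact ⟨⟨P, hP, rfl⟩, h0⟩
      refine mem_span_of_forall_comm fun R hR => ?_
      rw [comm_symm]
      exact comm_eq_zero_of_mem_span hall
        ((hL.span_eq R).2 fun T hT => by rw [comm_symm]; exact hR T hT)
    · intro hFS j
      rw [comm_symm]
      have hGj : G j ∈ Submodule.span (ZMod 2) (Set.range G) := Submodule.subset_span ⟨j, rfl⟩
      rw [hspan] at hGj
      refine comm_eq_zero_of_mem_span ?_ hGj
      intro P hP
      simp only [Set.mem_ofPred_eq, List.mem_filter, List.mem_map, List.mem_append,
        List.mem_ofFn, decide_eq_true_eq] at hP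
      obtain ⟨⟨R, hR, rfl⟩, -⟩ := hP
      rw [comm_restrict hF, comm_symm]
      have hRN := (hL.span_eq R).1 (Submodule.subset_span hR)
      exact comm_eq_zero_of_mem_span (fun T hT => by rw [comm_symm]; exact hRN T hT) hFS
  constructor
  · rintro ⟨P, hP, rfl⟩
    have hPA : reduceHom G H P ∈ supportedOn A := by
      rw [reduceHom_apply]
      exact Submodule.add_mem _ hP (Submodule.sum_mem _ fun j _ =>
        Submodule.smul_mem _ _ (support_subset_iff.1 (hHA j)))
    exact ⟨(hG hPA).1 (reduceHom_comm hGH P), hPA⟩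
  · rintro ⟨hFS, hFA⟩
    -- A stabilizer supported on `A` commutes with every `G j`, so the reduction fixes it.
    refine ⟨F, hFA, ?_⟩
    rw [reduceHom_apply]
    simp [(hG hFA).2 hFS]

/-- Echelon form yields the dual operators explicitly: the commutator with a suitable single-qubit
operator reads off the pivot entry of a row, and each pivot column is zero in all other rows. -/
theorem exists_restrictedRun (S : List (PauliBar Q)) {K : ℕ} (X Z : Fin K → PauliBar Q)
    (A : Finset Q) : ∃ out, RestrictedRun S X Z A out := by
  obtain ⟨ord, hord⟩ : ∃ ord : Q × Fin 2 → ℕ, Function.Injective ord :=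
    ⟨fun c => Fintype.equivFin _ c, fun a b h => (Fintype.equivFin _).injective (Fin.ext h)⟩
  set W := Submodule.span (ZMod 2)
    {P | P ∈ ((S ++ List.ofFn X ++ List.ofFn Z).map (PauliBar.restrict A)).filter (· ≠ 0)} with hW
  have hWA : W ≤ supportedOn A := by
    refine Submodule.span_le.2 fun P hP => ?_
    simp only [Set.mem_ofPred_eq, List.mem_filter, List.mem_map] at hP
    obtain ⟨⟨R, -, rfl⟩, -⟩ := hP
    exact restrict_mem_supportedOn A R
  obtain ⟨k, G, hG, hspan⟩ := exists_isRREF ord hord W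
  obtain ⟨piv, hpiv, hGpiv⟩ := id hG
  -- The operator `Z` detects the `X` component of a row and `X` detects the `Z` component, hence
  -- the exchange.
  let H : Fin k → PauliBar Q := fun i =>
    if (piv i).2 = 0 then Pi.single (piv i).1 (0, 1) else Pi.single (piv i).1 (1, 0)
  have hH : ∀ i (P : PauliBar Q), (H i).comm P = P.entry (piv i) := by
    intro i P
    rw [comm_symm]
    simp only [H, entry]
    split_ifs
    · exact comm_single_Z _ _
    · exact comm_single_X _ _
  have hpivA : ∀ i, (piv i).1 ∈ A := by
    intro i
    by_contra hi
    have h0 := hWA (hspan ▸ Submodule.subset_span ⟨i, rfl⟩ : G i ∈ W) _ hi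
    have h1 := (hGpiv i).1
    simp [entry, h0] at h1
  refine ⟨_, ord, k, G, H, hord, hG, hspan, fun i => ?_, fun i j => ?_, rfl⟩
  · rw [support_subset_iff]
    intro q hq
    have hne : q ≠ (piv i).1 := fun h => hq (h ▸ hpivA i)
    simp only [H]
    split_ifs <;> exact Pi.single_eq_of_ne hne _
  · rw [hH]
    split_ifs with h
    · rw [← h]; exact (hGpiv i).1
    · exact (hGpiv i).2.2 j (Ne.symm h)

end Restriction

/-! ### The radius of a connected graph -/

namespace SimpleGraph

variable {V : Type*} [Fintype V] {G : SimpleGraph V}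

/-- A finite connected graph has a vertex at distance at most half the number of vertices from every
vertex. Let `c` have minimal eccentricity `e`, and let `p₁` be its neighbour on a shortest path to a
vertex at distance `e`. A shortest path from `c` to a vertex at distance at least `e` from `p₁` meets
the first path in `c` only, so that there are at least `2 * e` vertices. -/
theorem exists_center (hG : G.Connected) :
    ∃ c, ∀ u, G.dist c u ≤ Fintype.card V / 2 := by
  classical
  have := hG.nonempty
  let ecc : V → ℕ := fun c => Finset.univ.sup (G.dist c)
  have hecc : ∀ c u, G.dist c u ≤ ecc c := fun c u => Finset.le_sup (Finset.mem_univ u)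
  obtain ⟨c, -, hc⟩ := Finset.exists_min_image Finset.univ ecc Finset.univ_nonempty
  -- Every vertex has eccentricity at least that of `c`.
  have hfar : ∀ v, ∃ w, ecc c ≤ G.dist v w := by
    intro v
    obtain ⟨w, -, hw⟩ := Finset.exists_mem_eq_sup Finset.univ Finset.univ_nonempty (G.dist v)
    exact ⟨w, hw ▸ hc v (Finset.mem_univ v)⟩
  refine ⟨c, fun u => (hecc c u).trans ?_⟩
  rw [Nat.le_div_iff_mul_le two_pos]
  obtain ⟨z, hz⟩ := hfar c
  replace hz : G.dist c z = ecc c := le_antisymm (hecc c z) hz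
  obtain ⟨p, hp, hpl⟩ := hG.exists_path_of_dist c z
  cases p with
  | nil =>
    rw [← hz, ← hpl]
    simp
  | @cons _ p₁ _ hadj p' =>
    obtain ⟨w, hw⟩ := hfar p₁
    obtain ⟨q, hq, hql⟩ := hG.exists_path_of_dist c w
    rw [Walk.length_cons, hz] at hpl
    -- If both paths met at `x ≠ c`, then `x` would be strictly closer to `p₁` than to `c` along
    -- them, because `p` is a shortest path. Passing through `x` would give `d(p₁, w) < d(c, w) ≤
    -- e`, against the choice of `w`.
    have hdisj : Disjoint (Walk.cons hadj p').support.toFinset (q.support.toFinset.erase c) := by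
      rw [Finset.disjoint_left]
      intro x hx hx'
      simp only [List.mem_toFinset, Walk.support_cons, List.mem_cons] at hx
      simp only [Finset.mem_erase, List.mem_toFinset] at hx'
      obtain ⟨hxc, hxq⟩ := hx'
      have hxp := hx.resolve_left hxc
      have h1 : (p'.takeUntil x hxp).length + (p'.dropUntil x hxp).length = p'.length := by
        rw [← Walk.length_append, Walk.take_spec]
      have h2 : (q.takeUntil x hxq).length + (q.dropUntil x hxq).length = q.length := by
        rw [← Walk.length_append, Walk.take_spec]
      have h3 := dist_le (p'.takeUntil x hxp)
      have h4 := dist_le (p'.dropUntil x hxp)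
      have h5 := dist_le (q.takeUntil x hxq)
      have h6 := dist_le (q.dropUntil x hxq)
      have h7 := hG.dist_triangle (u := c) (v := x) (w := z)
      have h8 := hG.dist_triangle (u := p₁) (v := x) (w := w)
      have h9 := hecc c w
      omega
    -- The first path has `e + 1` vertices. The second has `d(c, w)` vertices besides `c`, and `d(c,
    -- w) ≥ e - 1` because `p₁` is adjacent to `c`.
    have hcard := Finset.card_le_univ
      ((Walk.cons hadj p').support.toFinset ∪ q.support.toFinset.erase c)
    rw [Finset.card_union_of_disjoint hdisj, List.toFinset_card_of_nodup hp.support_nodup,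
      Finset.card_erase_of_mem (by simp), List.toFinset_card_of_nodup hq.support_nodup,
      Walk.length_support, Walk.length_support, Walk.length_cons, hpl, hql] at hcard
    have h1 := hG.dist_triangle (u := p₁) (v := c) (w := w)
    have h2 : G.dist p₁ c = 1 := dist_eq_one_iff_adj.2 hadj.symm
    omega

/-- A connected set of at most `M` vertices lies in a ball of radius `⌊M / 2⌋` around one of its
vertices. -/
theorem exists_edist_le_of_induce_connected {V : Type*} {G : SimpleGraph V} (s : Finset V)
    (hs : (G.induce (s : Set V)).Connected) {M : ℕ} (hM : s.card ≤ M) :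
    ∃ v, ∀ u ∈ s, G.edist v u ≤ ((M / 2 : ℕ) : ℕ∞) := by
  obtain ⟨c, hc⟩ := exists_center hs
  refine ⟨c, fun u hu => ?_⟩
  obtain ⟨p, hp⟩ := hs.exists_walk_length_eq_dist c ⟨u, hu⟩
  have h := hc ⟨u, hu⟩
  rw [← hp] at h
  -- A walk in the induced subgraph is a walk of the same length in `G`, so distances can only
  -- decrease.
  have hle := (p.map (Embedding.induce (G := G) (s : Set V)).toHom).edist_le
  rw [Walk.length_map] at hle
  refine hle.trans (Nat.cast_le.2 (h.trans (Nat.div_le_div_right ?_)))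
  simpa using hM

/-- A graph with exactly one connected component is connected. -/
theorem connected_iff_card_connectedComponent {V : Type*} {G : SimpleGraph V} :
    Nat.card G.ConnectedComponent = 1 ↔ G.Connected := by
  rw [Nat.card_eq_one_iff_unique]
  constructor
  · rintro ⟨h, ⟨c⟩⟩
    obtain ⟨v, -⟩ := c.exists_rep
    exact (connected_iff G).2 ⟨fun u w => ConnectedComponent.exact (Subsingleton.elim _ _), ⟨v⟩⟩
  · intro h
    exact ⟨h.preconnected.subsingleton_connectedComponent, ⟨G.connectedComponentMk h.nonempty.some⟩⟩

end SimpleGraph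

/-! ### Pauli matrices -/

/-- The sign `(-1)^a`. -/
noncomputable def signOf (a : ZMod 2) : ℂ := if a = 0 then 1 else -1

@[simp]
theorem signOf_zero : signOf 0 = 1 := if_pos rfl

@[simp]
theorem signOf_one : signOf 1 = -1 := if_neg one_ne_zero

theorem signOf_add (a b : ZMod 2) : signOf (a + b) = signOf a * signOf b := by
  rcases ZMod.eq_zero_or_eq_one a with rfl | rfl <;>
    rcases ZMod.eq_zero_or_eq_one b with rfl | rfl <;> simp [CharTwo.add_self_eq_zero]

theorem signOf_mul_self (a : ZMod 2) : signOf a * signOf a = 1 := by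
  rw [← signOf_add, CharTwo.add_self_eq_zero, signOf_zero]

theorem signOf_sum {ι : Type*} (s : Finset ι) (f : ι → ZMod 2) :
    signOf (∑ i ∈ s, f i) = ∏ i ∈ s, signOf (f i) := by
  classical
  induction s using Finset.induction_on with
  | empty => simp
  | insert i s hi ih => rw [Finset.sum_insert hi, Finset.prod_insert hi, signOf_add, ih]

theorem pauliMatrixOne_mul (a b : ZMod 2 × ZMod 2) :
    ∃ k : ℕ, pauliMatrixOne a * pauliMatrixOne b = Complex.I ^ k • pauliMatrixOne (a + b) := by
  -- Bounding the exponent turns the existential into a finite disjunction, which `simp` decides in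
  -- each of the 16 cases.
  have key : ∃ k ∈ Finset.range 4,
      pauliMatrixOne a * pauliMatrixOne b = Complex.I ^ k • pauliMatrixOne (a + b) := by
    obtain ⟨a₁, a₂⟩ := a
    obtain ⟨b₁, b₂⟩ := b
    rcases ZMod.eq_zero_or_eq_one a₁ with rfl | rfl <;>
    rcases ZMod.eq_zero_or_eq_one a₂ with rfl | rfl <;>
    rcases ZMod.eq_zero_or_eq_one b₁ with rfl | rfl <;>
    rcases ZMod.eq_zero_or_eq_one b₂ with rfl | rfl <;>
    simp [pauliMatrixOne, Finset.range_add_one, CharTwo.add_self_eq_zero, Matrix.one_fin_two,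
      Complex.I_sq, Complex.I_pow_three]
  obtain ⟨k, -, hk⟩ := key
  exact ⟨k, hk⟩

theorem pauliMatrixOne_comm (a b : ZMod 2 × ZMod 2) :
    pauliMatrixOne a * pauliMatrixOne b =
      signOf (a.1 * b.2 + a.2 * b.1) • (pauliMatrixOne b * pauliMatrixOne a) := by
  obtain ⟨a₁, a₂⟩ := a
  obtain ⟨b₁, b₂⟩ := b
  rcases ZMod.eq_zero_or_eq_one a₁ with rfl | rfl <;>
  rcases ZMod.eq_zero_or_eq_one a₂ with rfl | rfl <;>
  rcases ZMod.eq_zero_or_eq_one b₁ with rfl | rfl <;>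
  rcases ZMod.eq_zero_or_eq_one b₂ with rfl | rfl <;>
  simp [pauliMatrixOne, CharTwo.add_self_eq_zero]

theorem pauliMatrixOne_mul_self (a : ZMod 2 × ZMod 2) :
    pauliMatrixOne a * pauliMatrixOne a = 1 := by
  obtain ⟨a₁, a₂⟩ := a
  rcases ZMod.eq_zero_or_eq_one a₁ with rfl | rfl <;>
  rcases ZMod.eq_zero_or_eq_one a₂ with rfl | rfl <;>
  simp [pauliMatrixOne, Matrix.one_fin_two]

theorem trace_pauliMatrixOne {a : ZMod 2 × ZMod 2} (ha : a ≠ 0) :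
    (pauliMatrixOne a).trace = 0 := by
  obtain ⟨a₁, a₂⟩ := a
  rcases ZMod.eq_zero_or_eq_one a₁ with rfl | rfl <;>
  rcases ZMod.eq_zero_or_eq_one a₂ with rfl | rfl <;>
  simp_all [pauliMatrixOne, Matrix.trace_fin_two]

section

variable {n : ℕ}

/-- Tensor products multiply factor by factor: the sum over intermediate bit strings of a product
over qubits is the product over qubits of sums over one bit. -/
theorem of_prod_mul (f g : Fin n → Matrix (Fin 2) (Fin 2) ℂ) :
    (Matrix.of fun b b' : Fin n → Fin 2 => ∏ q, f q (b q) (b' q)) *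
      (Matrix.of fun b b' : Fin n → Fin 2 => ∏ q, g q (b q) (b' q)) =
      Matrix.of fun b b' => ∏ q, (f q * g q) (b q) (b' q) := by
  ext b b'
  simp only [Matrix.mul_apply, Matrix.of_apply]
  rw [Finset.prod_univ_sum, Fintype.piFinset_univ]
  exact Finset.sum_congr rfl fun c _ => Finset.prod_mul_distrib.symm

theorem pauliMatrix_mul_eq (p q : PauliBar (Fin n)) : pauliMatrix p * pauliMatrix q =
    Matrix.of fun b b' => ∏ i, (pauliMatrixOne (p i) * pauliMatrixOne (q i)) (b i) (b' i) :=
  of_prod_mul (fun i => pauliMatrixOne (p i)) fun i => pauliMatrixOne (q i)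

theorem pauliMatrix_mul (p q : PauliBar (Fin n)) :
    ∃ k : ℕ, pauliMatrix p * pauliMatrix q = Complex.I ^ k • pauliMatrix (p + q) := by
  choose k hk using fun i => pauliMatrixOne_mul (p i) (q i)
  refine ⟨∑ i, k i, ?_⟩
  rw [pauliMatrix_mul_eq]
  ext b b'
  simp only [hk, Matrix.of_apply, Matrix.smul_apply, smul_eq_mul, Finset.prod_mul_distrib,
    Finset.prod_pow_eq_pow_sum, pauliMatrix, Pi.add_apply]

theorem pauliMatrix_comm (p q : PauliBar (Fin n)) :
    pauliMatrix p * pauliMatrix q = signOf (p.comm q) • (pauliMatrix q * pauliMatrix p) := by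
  rw [pauliMatrix_mul_eq, pauliMatrix_mul_eq, PauliBar.comm, signOf_sum]
  ext b b'
  simp only [Matrix.of_apply, Matrix.smul_apply, smul_eq_mul, ← Finset.prod_mul_distrib]
  exact Finset.prod_congr rfl fun i _ => by
    rw [pauliMatrixOne_comm, Matrix.smul_apply, smul_eq_mul]

theorem of_prod_one : (Matrix.of fun b b' : Fin n → Fin 2 =>
    ∏ q, (1 : Matrix (Fin 2) (Fin 2) ℂ) (b q) (b' q)) = 1 := by
  ext b b'
  rw [Matrix.of_apply, Matrix.one_apply]
  split_ifs with h
  · exact Finset.prod_eq_one fun q _ => by rw [h, Matrix.one_apply_eq]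
  · obtain ⟨q, hq⟩ := Function.ne_iff.1 h
    exact Finset.prod_eq_zero (Finset.mem_univ q) (Matrix.one_apply_ne hq)

theorem pauliMatrix_mul_self (p : PauliBar (Fin n)) : pauliMatrix p * pauliMatrix p = 1 := by
  rw [pauliMatrix_mul_eq]
  simp only [pauliMatrixOne_mul_self]
  exact of_prod_one

theorem pauliMatrixOne_zero : pauliMatrixOne 0 = 1 := if_pos rfl

theorem pauliMatrix_zero : pauliMatrix (0 : PauliBar (Fin n)) = 1 := by
  rw [pauliMatrix]
  simp only [Pi.zero_apply, pauliMatrixOne_zero]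
  exact of_prod_one

theorem trace_pauliMatrix {p : PauliBar (Fin n)} (hp : p ≠ 0) : (pauliMatrix p).trace = 0 := by
  obtain ⟨q, hq⟩ := Function.ne_iff.1 hp
  have : (pauliMatrix p).trace = ∏ q, (pauliMatrixOne (p q)).trace := by
    simp only [Matrix.trace, Matrix.diag_apply]
    rw [Finset.prod_univ_sum, Fintype.piFinset_univ]
    rfl
  rw [this]
  exact Finset.prod_eq_zero (Finset.mem_univ q) (trace_pauliMatrixOne hq)

theorem trace_one_ne_zero : (1 : Matrix (Fin n → Fin 2) (Fin n → Fin 2) ℂ).trace ≠ 0 := by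
  rw [Matrix.trace_one]
  exact Nat.cast_ne_zero.2 Fintype.card_ne_zero

theorem I_pow_ne_zero (k : ℕ) : Complex.I ^ k ≠ 0 := pow_ne_zero k Complex.I_ne_zero

/-! ### Classes up to phase -/

/-- Trace orthogonality: for `p ≠ q` the product of the two Pauli matrices is a phase times a
non-trivial Pauli matrix and has trace `0`, while proportionality would make it a non-zero multiple
of the identity. -/
theorem IsPauliWithClass.unique {P : QubitUnitary n} {p q : PauliBar (Fin n)}
    (hp : IsPauliWithClass P p) (hq : IsPauliWithClass P q) : p = q := by
  obtain ⟨k, hk⟩ := hp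
  obtain ⟨l, hl⟩ := hq
  obtain ⟨m, hm⟩ := pauliMatrix_mul p q
  by_contra hne
  have hpq : p + q ≠ 0 := fun h => hne (by rw [eq_neg_of_add_eq_zero_left h, ZModModule.neg_eq_self])
  have h1 : Complex.I ^ k • (pauliMatrix p * pauliMatrix q) =
      Complex.I ^ l • (1 : Matrix (Fin n → Fin 2) (Fin n → Fin 2) ℂ) := by
    rw [← Matrix.smul_mul, ← hk, hl, Matrix.smul_mul, pauliMatrix_mul_self]
  have h2 := congrArg Matrix.trace h1
  rw [hm, Matrix.trace_smul, Matrix.trace_smul, Matrix.trace_smul, trace_pauliMatrix hpq,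
    smul_zero, smul_zero, smul_eq_mul] at h2
  exact mul_ne_zero (I_pow_ne_zero l) trace_one_ne_zero h2.symm

theorem IsPauliWithClass.pauliClass_eq {P : QubitUnitary n} {p : PauliBar (Fin n)}
    (hp : IsPauliWithClass P p) : pauliClass P = p := by
  have h : ∃ p, IsPauliWithClass P p := ⟨p, hp⟩
  rw [pauliClass, dif_pos h]
  exact h.choose_spec.unique hp

theorem isPauliWithClass_pauliOp (p : PauliBar (Fin n)) : IsPauliWithClass (pauliOp p) p :=
  ⟨0, by simp [pauliOp]⟩

theorem isPauliWithClass_one : IsPauliWithClass (1 : QubitUnitary n) 0 :=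
  ⟨0, by simp [pauliMatrix_zero]⟩

theorem IsPauliWithClass.mul {P R : QubitUnitary n} {p r : PauliBar (Fin n)}
    (hP : IsPauliWithClass P p) (hR : IsPauliWithClass R r) : IsPauliWithClass (P * R) (p + r) := by
  obtain ⟨k, hk⟩ := hP
  obtain ⟨l, hl⟩ := hR
  obtain ⟨m, hm⟩ := pauliMatrix_mul p r
  refine ⟨k + l + m, ?_⟩
  rw [Submonoid.coe_mul, hk, hl, Matrix.smul_mul, Matrix.mul_smul, hm, smul_smul, smul_smul,
    pow_add, pow_add, mul_assoc]

theorem IsPauliWithClass.comm {P R : QubitUnitary n} {p r : PauliBar (Fin n)}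
    (hP : IsPauliWithClass P p) (hR : IsPauliWithClass R r) :
    (P : Matrix (Fin n → Fin 2) (Fin n → Fin 2) ℂ) * R =
      signOf (p.comm r) • ((R : Matrix (Fin n → Fin 2) (Fin n → Fin 2) ℂ) * P) := by
  obtain ⟨k, hk⟩ := hP
  obtain ⟨l, hl⟩ := hR
  rw [hk, hl]
  simp only [Matrix.smul_mul, Matrix.mul_smul]
  rw [pauliMatrix_comm]
  simp only [smul_smul]
  congr 1
  ring

theorem IsPauliWithClass.neg {P : QubitUnitary n} {p : PauliBar (Fin n)}
    (hP : IsPauliWithClass P p) : IsPauliWithClass (-P) p := by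
  obtain ⟨k, hk⟩ := hP
  refine ⟨k + 2, ?_⟩
  rw [pow_add, Complex.I_sq, mul_neg_one, neg_smul, ← hk]
  rfl

theorem QubitUnitary.coe_ne_zero (P : QubitUnitary n) :
    (P : Matrix (Fin n → Fin 2) (Fin n → Fin 2) ℂ) ≠ 0 := by
  intro h
  have h1 : (P : Matrix (Fin n → Fin 2) (Fin n → Fin 2) ℂ) * star (P : Matrix _ _ ℂ) = 1 :=
    (Unitary.mem_iff.1 P.2).2
  rw [h, zero_mul] at h1
  exact trace_one_ne_zero (n := n) (by rw [← h1, Matrix.trace_zero])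

theorem QubitUnitary.ne_neg (P : QubitUnitary n) : P ≠ -P := by
  intro h
  have h1 : (P : Matrix (Fin n → Fin 2) (Fin n → Fin 2) ℂ) = -P := congrArg Subtype.val h
  refine P.coe_ne_zero (Matrix.ext fun i j => self_eq_neg.1 ?_)
  exact congrFun (congrFun h1 i) j

theorem IsPauliWithClass.mul_comm_of_comm_eq_zero {P R : QubitUnitary n} {p r : PauliBar (Fin n)}
    (hP : IsPauliWithClass P p) (hR : IsPauliWithClass R r) (h : p.comm r = 0) : P * R = R * P :=
  Subtype.ext (by simpa [h] using hP.comm hR)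

theorem IsPauliWithClass.mul_comm_of_comm_eq_one {P R : QubitUnitary n} {p r : PauliBar (Fin n)}
    (hP : IsPauliWithClass P p) (hR : IsPauliWithClass R r) (h : p.comm r = 1) :
    P * R = -(R * P) :=
  Subtype.ext ((hP.comm hR).trans (by rw [h, signOf_one, neg_one_smul]; rfl))

theorem IsPauliWithClass.comm_eq_zero_iff {P R : QubitUnitary n} {p r : PauliBar (Fin n)}
    (hP : IsPauliWithClass P p) (hR : IsPauliWithClass R r) : p.comm r = 0 ↔ P * R = R * P := by
  refine ⟨hP.mul_comm_of_comm_eq_zero hR, fun h => ?_⟩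
  refine (ZMod.eq_zero_or_eq_one _).resolve_right fun h1 => ?_
  have h2 := hP.mul_comm_of_comm_eq_one hR h1
  rw [h] at h2
  exact (R * P).ne_neg h2

/-! ### Conjugation by Clifford operators -/

theorem IsClifford.one : IsClifford (1 : QubitUnitary n) := fun P => by simp

theorem IsClifford.mul {U V : QubitUnitary n} (hU : IsClifford U) (hV : IsClifford V) :
    IsClifford (U * V) := fun P => by
  rw [← hV P, ← hU (V * P * V⁻¹)]
  simp [mul_assoc]

theorem IsClifford.inv {U : QubitUnitary n} (hU : IsClifford U) : IsClifford U⁻¹ := fun P => by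
  rw [← hU (U⁻¹ * P * U⁻¹⁻¹)]
  simp [mul_assoc]

theorem IsClifford.conjInv_spec {U : QubitUnitary n} (hU : IsClifford U) (p : PauliBar (Fin n)) :
    IsPauliWithClass (U⁻¹ * pauliOp p * U) (conjInv U p) := by
  obtain ⟨q, hq⟩ := (hU.inv (pauliOp p)).2 ⟨p, isPauliWithClass_pauliOp p⟩
  rw [inv_inv] at hq
  rw [conjInv, hq.pauliClass_eq]
  exact hq

theorem IsPauliWithClass.conjInv {U : QubitUnitary n} (hU : IsClifford U) {P : QubitUnitary n}
    {p : PauliBar (Fin n)} (hP : IsPauliWithClass P p) :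
    IsPauliWithClass (U⁻¹ * P * U) (conjInv U p) := by
  obtain ⟨k, hk⟩ := hP
  obtain ⟨l, hl⟩ := hU.conjInv_spec p
  refine ⟨k + l, ?_⟩
  rw [pow_add, mul_smul, ← hl]
  simp only [Submonoid.coe_mul, hk, Matrix.smul_mul, Matrix.mul_smul]
  rfl

theorem conjInv_one (p : PauliBar (Fin n)) : conjInv 1 p = p := by
  have h := (isPauliWithClass_pauliOp p).conjInv IsClifford.one
  rw [inv_one, one_mul, mul_one] at h
  exact h.unique (isPauliWithClass_pauliOp p)

theorem conjInv_mul {U V : QubitUnitary n} (hU : IsClifford U) (hV : IsClifford V)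
    (p : PauliBar (Fin n)) : conjInv (U * V) p = conjInv V (conjInv U p) := by
  have h := ((isPauliWithClass_pauliOp p).conjInv hU).conjInv hV
  refine ((isPauliWithClass_pauliOp p).conjInv (hU.mul hV)).unique ?_
  convert h using 1
  simp [mul_assoc]

theorem conjInv_conjInv_inv {U : QubitUnitary n} (hU : IsClifford U) (p : PauliBar (Fin n)) :
    conjInv U (conjInv U⁻¹ p) = p := by
  rw [← conjInv_mul hU.inv hU, inv_mul_cancel, conjInv_one]

theorem conjInv_inv_conjInv {U : QubitUnitary n} (hU : IsClifford U) (p : PauliBar (Fin n)) :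
    conjInv U⁻¹ (conjInv U p) = p := by
  rw [← conjInv_mul hU hU.inv, mul_inv_cancel, conjInv_one]

theorem conjInv_add {U : QubitUnitary n} (hU : IsClifford U) (p q : PauliBar (Fin n)) :
    conjInv U (p + q) = conjInv U p + conjInv U q := by
  have h := ((isPauliWithClass_pauliOp p).mul (isPauliWithClass_pauliOp q)).conjInv hU
  refine h.unique ?_
  convert ((isPauliWithClass_pauliOp p).conjInv hU).mul ((isPauliWithClass_pauliOp q).conjInv hU)
    using 1
  simp [mul_assoc]

theorem conjInv_zero {U : QubitUnitary n} (hU : IsClifford U) : conjInv U 0 = 0 := by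
  have h := conjInv_add hU 0 0
  rw [add_zero] at h
  exact left_eq_add.1 h

/-- Conjugation by a Clifford operator as a linear map. -/
noncomputable def conjInvHom (U : QubitUnitary n) (hU : IsClifford U) :
    PauliBar (Fin n) →ₗ[ZMod 2] PauliBar (Fin n) where
  toFun := conjInv U
  map_add' := conjInv_add hU
  map_smul' a p := by
    rcases ZMod.eq_zero_or_eq_one a with rfl | rfl <;> simp [conjInv_zero hU]

/-- An operator acting on `A` commutes with the Pauli operators that are trivial on `A`. -/
theorem ActsOn.mul_comm {U : QubitUnitary n} {A : Finset (Fin n)} (hU : ActsOn U A)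
    {p : PauliBar (Fin n)} (hp : ∀ q ∈ A, p q = 0) : U * pauliOp p = pauliOp p * U := by
  obtain ⟨u, hu⟩ := hU
  apply Subtype.ext
  ext b b'
  -- Since `U` does not change the bits outside `A` and the Pauli operator does not change those
  -- inside, each matrix product has a single possibly non-zero term; `c₁` and `c₂` are the
  -- intermediate bit strings for the two orders.
  let c₁ : Fin n → Fin 2 := fun q => if q ∈ A then b' q else b q
  let c₂ : Fin n → Fin 2 := fun q => if q ∈ A then b q else b' q
  have hP : ∀ d d' : Fin n → Fin 2, (∃ q ∈ A, d q ≠ d' q) → pauliMatrix p d d' = 0 := by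
    rintro d d' ⟨q, hq, hne⟩
    refine Finset.prod_eq_zero (Finset.mem_univ q) ?_
    rw [hp q hq, pauliMatrixOne_zero, Matrix.one_apply_ne hne]
  have h1 : (U.1 * pauliMatrix p) b b' = U.1 b c₁ * pauliMatrix p c₁ b' := by
    rw [Matrix.mul_apply]
    refine Finset.sum_eq_single c₁ (fun d _ hd => ?_) (by simp)
    obtain ⟨q, hq⟩ := Function.ne_iff.1 hd
    by_cases hqA : q ∈ A
    · rw [hP d b' ⟨q, hqA, by simpa [c₁, hqA] using hq⟩, mul_zero]
    · rw [hu, if_neg, zero_mul]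
      intro h
      exact hq (by simpa [c₁, hqA] using (h q hqA).symm)
  have h2 : (pauliMatrix p * U.1) b b' = pauliMatrix p b c₂ * U.1 c₂ b' := by
    rw [Matrix.mul_apply]
    refine Finset.sum_eq_single c₂ (fun d _ hd => ?_) (by simp)
    obtain ⟨q, hq⟩ := Function.ne_iff.1 hd
    by_cases hqA : q ∈ A
    · rw [hP b d ⟨q, hqA, fun h => hq (by simpa [c₂, hqA] using h.symm)⟩, zero_mul]
    · rw [hu, if_neg, mul_zero]
      intro h
      exact hq (by simpa [c₂, hqA] using h q hqA)
  change (U.1 * pauliMatrix p) b b' = (pauliMatrix p * U.1) b b'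
  rw [h1, h2, _root_.mul_comm (U.1 b c₁), hu b c₁, hu c₂ b',
    if_pos (fun q hq => by simp [c₁, hq]), if_pos (fun q hq => by simp [c₂, hq])]
  congr 1
  · change ∏ q, pauliMatrixOne (p q) (c₁ q) (b' q) = ∏ q, pauliMatrixOne (p q) (b q) (c₂ q)
    refine Finset.prod_congr rfl fun q _ => ?_
    by_cases hq : q ∈ A
    · simp [hp q hq, pauliMatrixOne_zero, c₁, c₂, hq]
    · simp [c₁, c₂, hq]
  · congr 1 <;> funext q <;> simp [c₁, c₂]

theorem ActsOn.conjInv_eq {U : QubitUnitary n} {A : Finset (Fin n)} (hU : ActsOn U A)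
    (hC : IsClifford U) {p : PauliBar (Fin n)} (hp : ∀ q ∈ A, p q = 0) : conjInv U p = p := by
  refine (hC.conjInv_spec p).unique ?_
  rw [mul_assoc, ← hU.mul_comm hp, inv_mul_cancel_left]
  exact isPauliWithClass_pauliOp p

end

/-! ### Products of projectors onto eigenspaces of commuting Pauli operators -/

section StabilizerProduct

variable {n : ℕ} {J : Type} [Fintype J]

/-- The product of the operators `1 + (-1)^(w ⬝ o) T`, a multiple of the projector onto the joint
eigenspace of the operators `T` with eigenvalues `(-1)^(w ⬝ o)`. -/
noncomputable def stabProd (o : J → ZMod 2) (L : List (QubitUnitary n × (J → ZMod 2))) :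
    Matrix (Fin n → Fin 2) (Fin n → Fin 2) ℂ :=
  (L.map fun T => 1 + signOf (∑ j, T.2 j * o j) • T.1.1).prod

theorem stabProd_nil (o : J → ZMod 2) : stabProd (n := n) o [] = 1 := rfl

theorem stabProd_cons (o : J → ZMod 2) (T : QubitUnitary n × (J → ZMod 2))
    (L : List (QubitUnitary n × (J → ZMod 2))) :
    stabProd o (T :: L) = (1 + signOf (∑ j, T.2 j * o j) • T.1.1) * stabProd o L := by
  rw [stabProd, List.map_cons, List.prod_cons]; rfl

theorem stabProd_append (o : J → ZMod 2) (L L' : List (QubitUnitary n × (J → ZMod 2))) :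
    stabProd o (L ++ L') = stabProd o L * stabProd o L' := by
  rw [stabProd, List.map_append, List.prod_append]; rfl

theorem stabProd_singleton (o : J → ZMod 2) (T : QubitUnitary n × (J → ZMod 2)) :
    stabProd o [T] = 1 + signOf (∑ j, T.2 j * o j) • T.1.1 := by
  rw [stabProd_cons, stabProd_nil, mul_one]

theorem commute_stabProd {A : Matrix (Fin n → Fin 2) (Fin n → Fin 2) ℂ} (o : J → ZMod 2)
    {L : List (QubitUnitary n × (J → ZMod 2))} (h : ∀ T ∈ L, Commute A T.1.1) :
    Commute A (stabProd o L) := by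
  induction L with
  | nil => exact Commute.one_right A
  | cons T L ih =>
    rw [stabProd_cons]
    exact ((Commute.one_right A).add_right ((h T (by simp)).smul_right _)).mul_right
      (ih fun T' hT' => h T' (by simp [hT']))

/-- Pairwise commuting Hermitian Pauli operators. -/
structure IsStabilizerList (L : List (QubitUnitary n × (J → ZMod 2))) : Prop where
  isPauli : ∀ T ∈ L, ∃ p, IsPauliWithClass T.1 p
  mul_self : ∀ T ∈ L, T.1 * T.1 = 1
  commute : ∀ T ∈ L, ∀ T' ∈ L, Commute T.1 T'.1

theorem Commute.coe_unitary {U V : QubitUnitary n} (h : Commute U V) : Commute U.1 V.1 :=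
  congrArg Subtype.val h

namespace IsStabilizerList

variable {L : List (QubitUnitary n × (J → ZMod 2))}

/-- From `T² = 1` and `e² = 1` follows `T (1 + e T) = e (1 + e T)`; commutation brings `T` next to
its own factor. -/
theorem mul_stabProd (hL : IsStabilizerList L) (o : J → ZMod 2)
    {T : QubitUnitary n × (J → ZMod 2)} (hT : T ∈ L) :
    T.1.1 * stabProd o L = signOf (∑ j, T.2 j * o j) • stabProd o L := by
  obtain ⟨L₁, L₂, rfl⟩ := List.append_of_mem hT
  have hcomm : Commute T.1.1 (stabProd o L₁) :=
    commute_stabProd o fun T' hT' =>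
      (hL.commute T hT T' (List.mem_append_left _ hT')).coe_unitary
  have hTT : T.1.1 * T.1.1 = 1 := congrArg Subtype.val (hL.mul_self T hT)
  have hkey : T.1.1 * (1 + signOf (∑ j, T.2 j * o j) • T.1.1) =
      signOf (∑ j, T.2 j * o j) • (1 + signOf (∑ j, T.2 j * o j) • T.1.1) := by
    rw [mul_add, mul_one, Matrix.mul_smul, hTT, smul_add, smul_smul, signOf_mul_self, one_smul,
      add_comm]
  rw [stabProd_append, stabProd_cons, ← mul_assoc, hcomm.eq, mul_assoc, ← mul_assoc T.1.1, hkey,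
    Matrix.smul_mul, Matrix.mul_smul]

theorem prod_mul_stabProd (hL : IsStabilizerList L) (o : J → ZMod 2)
    {L' : List (QubitUnitary n × (J → ZMod 2))} (h : ∀ T ∈ L', T ∈ L) :
    (L'.map Prod.fst).prod.1 * stabProd o L =
      signOf (∑ j, (L'.map Prod.snd).sum j * o j) • stabProd o L := by
  induction L' with
  | nil => simp
  | cons T L' ih =>
    have ih' := ih fun T' hT' => h T' (List.mem_cons_of_mem _ hT')
    rw [List.map_cons, List.prod_cons, Submonoid.coe_mul, mul_assoc, ih', Matrix.mul_smul,
      hL.mul_stabProd o (h T List.mem_cons_self), smul_smul, ← signOf_add, List.map_cons,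
      List.sum_cons]
    congr 2
    rw [← Finset.sum_add_distrib]
    exact Finset.sum_congr rfl fun j _ => by rw [Pi.add_apply]; ring

theorem commute_of_mem_closure {U : QubitUnitary n} (hU : ∀ T ∈ L, Commute U T.1)
    {g : QubitUnitary n} (hg : g ∈ Subgroup.closure {T | ∃ w, (T, w) ∈ L}) : Commute U g := by
  induction hg using Subgroup.closure_induction with
  | mem x hx => obtain ⟨w, hw⟩ := hx; exact hU _ hw
  | one => exact Commute.one_right U
  | mul x y _ _ hx hy => exact hx.mul_right hy
  | inv x _ hx => exact hx.inv_right

theorem mem_closure (hL : IsStabilizerList L) {g : QubitUnitary n}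
    (hg : g ∈ Subgroup.closure {T | ∃ w, (T, w) ∈ L}) :
    (∃ p, IsPauliWithClass g p) ∧ g * g = 1 := by
  induction hg using Subgroup.closure_induction with
  | mem x hx =>
    obtain ⟨w, hw⟩ := hx
    exact ⟨hL.isPauli _ hw, hL.mul_self _ hw⟩
  | one => exact ⟨⟨0, isPauliWithClass_one⟩, one_mul 1⟩
  | mul x y hx' hy' hx hy =>
    obtain ⟨⟨p, hp⟩, hxx⟩ := hx
    obtain ⟨⟨q, hq⟩, hyy⟩ := hy
    have hxy : Commute y x := commute_of_mem_closure (fun T hT =>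
      (commute_of_mem_closure (fun T' hT' => hL.commute T hT T' hT') hy').symm) hx'
    refine ⟨⟨p + q, hp.mul hq⟩, ?_⟩
    rw [mul_assoc, ← mul_assoc y, hxy.eq, mul_assoc, hyy, mul_one, hxx]
  | inv x _ hx =>
    rw [inv_eq_of_mul_eq_one_left hx.2]
    exact hx

/-- The elements of the group are involutions, so inverses can be dispensed with. This provides the
decomposition that the algorithm needs when `± S_j` is in the group. -/
theorem exists_prod_eq (hL : IsStabilizerList L) {g : QubitUnitary n}
    (hg : g ∈ Subgroup.closure {T | ∃ w, (T, w) ∈ L}) :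
    ∃ L' : List (QubitUnitary n × (J → ZMod 2)), (∀ T ∈ L', T ∈ L) ∧
      (L'.map Prod.fst).prod = g := by
  induction hg using Subgroup.closure_induction with
  | mem x hx =>
    obtain ⟨w, hw⟩ := hx
    exact ⟨[(x, w)], by simpa using hw, by simp⟩
  | one => exact ⟨[], by simp, rfl⟩
  | mul x y _ _ hx hy =>
    obtain ⟨L₁, h₁, rfl⟩ := hx
    obtain ⟨L₂, h₂, rfl⟩ := hy
    refine ⟨L₁ ++ L₂, fun T hT => ?_, by simp⟩
    rcases List.mem_append.1 hT with hT | hT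
    exacts [h₁ T hT, h₂ T hT]
  | inv x hx' hx => rwa [inv_eq_of_mul_eq_one_left (hL.mem_closure hx').2]

/-- Expanding `stabProd` gives a signed sum of elements of `H`, so the trace against `A` vanishes as
soon as it does for each group element. The extra factor `g` lets the induction absorb one generator
at a time. -/
theorem trace_mul_stabProd_mul {H : Subgroup (QubitUnitary n)} (hLH : ∀ T ∈ L, T.1 ∈ H)
    (o : J → ZMod 2) {A : Matrix (Fin n → Fin 2) (Fin n → Fin 2) ℂ}
    (hA : ∀ g ∈ H, (g.1 * A).trace = 0) : ∀ g ∈ H, (g.1 * stabProd o L * A).trace = 0 := by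
  induction L with
  | nil => simpa [stabProd_nil] using hA
  | cons T L ih =>
    intro g hg
    have ih' := ih fun T' hT' => hLH T' (List.mem_cons_of_mem _ hT')
    have h : g.1 * stabProd o (T :: L) * A = g.1 * stabProd o L * A +
        signOf (∑ j, T.2 j * o j) • ((g * T.1).1 * stabProd o L * A) := by
      rw [stabProd_cons, add_mul, mul_add, add_mul, one_mul, Submonoid.coe_mul]
      simp only [Matrix.mul_smul, Matrix.smul_mul, mul_assoc]
    rw [h, Matrix.trace_add, Matrix.trace_smul, ih' g hg,
      ih' _ (H.mul_mem hg (hLH T List.mem_cons_self)), smul_zero, add_zero]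

/-- The trace of `stabProd` times a Hermitian Pauli operator `S` that commutes with the stabilizers
vanishes, unless `S` or `-S` is a product of stabilizers. -/
theorem trace_stabProd_mul_eq_zero (hL : IsStabilizerList L) (o : J → ZMod 2)
    {S : QubitUnitary n} {s : PauliBar (Fin n)} (hS : IsPauliWithClass S s) (hSS : S * S = 1)
    (hcomm : ∀ T ∈ L, Commute S T.1)
    (hplus : S ∉ Subgroup.closure {T | ∃ w, (T, w) ∈ L})
    (hminus : -S ∉ Subgroup.closure {T | ∃ w, (T, w) ∈ L}) :
    (stabProd o L * S.1).trace = 0 := by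
  have h := trace_mul_stabProd_mul (L := L) (A := S.1)
    (H := Subgroup.closure {T | ∃ w, (T, w) ∈ L})
    (fun T hT => Subgroup.subset_closure ⟨T.2, hT⟩) o (fun g hg => ?_) 1 (Subgroup.one_mem _)
  · simpa using h
  obtain ⟨⟨p, hp⟩, hgg⟩ := hL.mem_closure hg
  have hSg : Commute S g := commute_of_mem_closure hcomm hg
  obtain ⟨k, hk⟩ := hp.mul hS
  rw [Submonoid.coe_mul] at hk
  -- The trace of `g S` vanishes unless `g S` is a scalar. In that case `(g S)² = 1` forces the
  -- scalar to be `± 1`, so that `g = ± S`, against the hypotheses.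
  by_cases hps : p + s = 0
  swap
  · rw [hk, Matrix.trace_smul, trace_pauliMatrix hps, smul_zero]
  exfalso
  rw [hps, pauliMatrix_zero] at hk
  have h1 : (g * S) * (g * S) = 1 := by
    rw [mul_assoc, ← mul_assoc S, hSg.eq, mul_assoc, hSS, mul_one, hgg]
  have h2 : (Complex.I ^ k * Complex.I ^ k) • (1 : Matrix (Fin n → Fin 2) (Fin n → Fin 2) ℂ) =
      (1 : ℂ) • 1 := by
    have := congrArg Subtype.val h1
    rw [Submonoid.coe_mul, Submonoid.coe_mul, hk] at this
    rw [one_smul, ← smul_smul]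
    simpa using this
  have h3 : Complex.I ^ k * Complex.I ^ k = 1 := by
    have := congrArg Matrix.trace h2
    rw [Matrix.trace_smul, Matrix.trace_smul, smul_eq_mul, smul_eq_mul] at this
    exact mul_right_cancel₀ trace_one_ne_zero this
  have hg' : g.1 = Complex.I ^ k • S.1 := by
    have h4 : g.1 = (g.1 * S.1) * S.1 := by
      have := congrArg Subtype.val hSS
      rw [Submonoid.coe_mul] at this
      rw [mul_assoc, this]; exact (mul_one _).symm
    rw [h4, hk, Matrix.smul_mul, one_mul]
  rcases mul_self_eq_one_iff.1 h3 with h5 | h5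
  · rw [h5, one_smul] at hg'
    exact hplus ((Subtype.ext hg' : g = S) ▸ hg)
  · rw [h5, neg_one_smul] at hg'
    exact hminus ((Subtype.ext hg' : g = -S) ▸ hg)

end IsStabilizerList

theorem stabProd_map_conj (U : QubitUnitary n) (o : J → ZMod 2)
    (L : List (QubitUnitary n × (J → ZMod 2))) :
    stabProd o (L.map fun T => (U * T.1 * U⁻¹, T.2)) = U.1 * stabProd o L * (U⁻¹).1 := by
  have hU : (U⁻¹).1 * U.1 = 1 := congrArg Subtype.val (inv_mul_cancel U)
  have hU' : U.1 * (U⁻¹).1 = 1 := congrArg Subtype.val (mul_inv_cancel U)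
  induction L with
  | nil => rw [List.map_nil, stabProd_nil, mul_one, hU']
  | cons T L ih =>
    rw [List.map_cons, stabProd_cons, ih, stabProd_cons]
    have h : (1 : Matrix _ _ ℂ) + signOf (∑ j, T.2 j * o j) • (U * T.1 * U⁻¹).1 =
        U.1 * (1 + signOf (∑ j, T.2 j * o j) • T.1.1) * (U⁻¹).1 := by
      rw [mul_add, add_mul, mul_one, hU', Matrix.mul_smul, Matrix.smul_mul]
      rfl
    rw [h]
    simp only [mul_assoc]
    rw [← mul_assoc (U⁻¹).1 U.1, hU, one_mul]

/-- Multiplying some of the stabilizers by `T` does not change the product with `1 ± T`. -/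
theorem stabProd_map_ite_mul (o : J → ZMod 2) (T : QubitUnitary n × (J → ZMod 2))
    (hTT : T.1 * T.1 = 1) (p : QubitUnitary n × (J → ZMod 2) → Prop)
    [DecidablePred p] {L : List (QubitUnitary n × (J → ZMod 2))} (h : ∀ T' ∈ L, Commute T.1 T'.1) :
    stabProd o (L.map fun T' => if p T' then (T.1 * T'.1, T.2 + T'.2) else T') *
      (1 + signOf (∑ j, T.2 j * o j) • T.1.1) =
    stabProd o L * (1 + signOf (∑ j, T.2 j * o j) • T.1.1) := by
  set e := signOf (∑ j, T.2 j * o j) with he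
  have hTT' : T.1.1 * T.1.1 = 1 := congrArg Subtype.val hTT
  have hee : e * e = 1 := signOf_mul_self _
  have hTE : T.1.1 * (1 + e • T.1.1) = e • (1 + e • T.1.1) := by
    rw [mul_add, mul_one, Matrix.mul_smul, hTT', smul_add, smul_smul, hee, one_smul, add_comm]
  induction L with
  | nil => rfl
  | cons T' L ih =>
    have ih' := ih fun T'' hT'' => h T'' (List.mem_cons_of_mem _ hT'')
    have hT' : Commute T.1.1 T'.1.1 := (h T' List.mem_cons_self).coe_unitary
    have hc : Commute (1 + e • T.1.1) (stabProd o L) :=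
      (Commute.one_left _).add_left ((commute_stabProd o fun T'' hT'' =>
        (h T'' (List.mem_cons_of_mem _ hT'')).coe_unitary).smul_left e)
    rw [List.map_cons, stabProd_cons, mul_assoc, ih', stabProd_cons, mul_assoc, ← hc.eq,
      ← mul_assoc, ← mul_assoc]
    congr 1
    split_ifs
    -- On the image of `1 + e T`, the operator `T` acts as `e`, so the factor `1 + e e' T T'` acts
    -- there as `1 + e' T'`.
    · have hsum : signOf (∑ j, (T.2 + T'.2) j * o j) = e * signOf (∑ j, T'.2 j * o j) := by
        rw [he, ← signOf_add, ← Finset.sum_add_distrib]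
        exact congrArg _ (Finset.sum_congr rfl fun j _ => by rw [Pi.add_apply]; ring)
      rw [hsum]
      change (1 + (e * _) • (T.1.1 * T'.1.1)) * _ = _
      rw [hT'.eq, add_mul, add_mul, Matrix.smul_mul, mul_assoc, hTE, Matrix.mul_smul, smul_smul,
        mul_right_comm, hee, one_mul, one_mul, Matrix.smul_mul]
    · rfl

end StabilizerProduct

/-! ### Measured operators and their projectors -/

namespace MeasuredPauli

variable {n : ℕ} (S : MeasuredPauli n)

theorem isPauliWithClass_op : IsPauliWithClass S.op S.pauli := by
  rw [op]
  split_ifs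
  · exact isPauliWithClass_pauliOp _
  · exact (isPauliWithClass_pauliOp _).neg

theorem op_mul_self : S.op * S.op = 1 := by
  have h : pauliOp S.pauli * pauliOp S.pauli = 1 := Subtype.ext (pauliMatrix_mul_self _)
  rw [op]
  split_ifs
  · exact h
  · rw [neg_mul_neg, h]

theorem conjTranspose_op : (S.op.1).conjTranspose = S.op.1 := by
  have h : S.op⁻¹ = S.op := inv_eq_of_mul_eq_one_left S.op_mul_self
  exact congrArg Subtype.val h

theorem projector_eq (o : ZMod 2) : S.projector o = (1 / 2 : ℂ) • (1 + signOf o • S.op.1) := rfl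

theorem conjTranspose_projector (o : ZMod 2) : (S.projector o).conjTranspose = S.projector o := by
  rw [projector_eq, Matrix.conjTranspose_smul, Matrix.conjTranspose_add, Matrix.conjTranspose_smul,
    Matrix.conjTranspose_one, conjTranspose_op]
  congr 1
  · simp
  · congr 2
    rcases ZMod.eq_zero_or_eq_one o with rfl | rfl <;> simp

theorem op_mul_projector (o : ZMod 2) : S.op.1 * S.projector o = signOf o • S.projector o := by
  have h : S.op.1 * S.op.1 = 1 := congrArg Subtype.val S.op_mul_self
  rw [projector_eq, Matrix.mul_smul, smul_comm (signOf o)]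
  congr 1
  rw [mul_add, mul_one, Matrix.mul_smul, h, smul_add, smul_smul, signOf_mul_self, one_smul,
    add_comm]

theorem projector_mul_self (o : ZMod 2) : S.projector o * S.projector o = S.projector o := by
  conv_lhs => enter [1]; rw [projector_eq]
  rw [Matrix.smul_mul, add_mul, one_mul, Matrix.smul_mul, op_mul_projector, smul_smul,
    signOf_mul_self, one_smul, ← two_smul ℂ, smul_smul]
  norm_num

end MeasuredPauli

namespace CliffordCircuit

variable {n : ℕ} (C : CliffordCircuit n)

theorem isClifford_unitaryPart (c : CliffordOperation n) : IsClifford c.unitaryPart := by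
  cases c with
  | gate g => exact g.isClifford
  | measure S => exact IsClifford.one

variable {C}

/-! ### Invariants of the computation of checks -/

theorem CheckStep.isStabilizerList {i : Fin C.size} {s s' : C.CheckState}
    (h : C.CheckStep i s s') (hs : IsStabilizerList s.gens) : IsStabilizerList s'.gens := by
  cases h with
  | gate _ hi =>
    set U := (C.op i).unitaryPart
    have hU : IsClifford U := isClifford_unitaryPart _
    have hmem : ∀ T ∈ s.gens.map fun T => (U * T.1 * U⁻¹, T.2), ∃ T' ∈ s.gens,
        T.1 = U * T'.1 * U⁻¹ := by
      intro T hT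
      obtain ⟨T', hT', rfl⟩ := List.mem_map.1 hT
      exact ⟨T', hT', rfl⟩
    refine ⟨fun T hT => ?_, fun T hT => ?_, fun T hT T' hT' => ?_⟩
    · obtain ⟨T', hT', h⟩ := hmem T hT
      rw [h]
      exact (hU _).2 (hs.isPauli T' hT')
    · obtain ⟨T', hT', h⟩ := hmem T hT
      rw [h]
      have := hs.mul_self T' hT'
      simp only [mul_assoc, inv_mul_cancel_left]
      rw [← mul_assoc T'.1, this, one_mul, mul_inv_cancel]
    · obtain ⟨T₁, hT₁, h⟩ := hmem T hT
      obtain ⟨T₂, hT₂, h'⟩ := hmem T' hT'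
      rw [h, h', Commute.conj_iff]
      exact hs.commute T₁ hT₁ T₂ hT₂
  | plus => exact hs
  | minus => exact hs
  | commuting j _ hplus hminus hcomm =>
    have hS := (C.measured j).isPauliWithClass_op
    -- Pauli operators either commute or anticommute, so failure to anticommute suffices.
    have hc : ∀ T ∈ s.gens, Commute T.1 (C.measured j).op := by
      intro T hT
      obtain ⟨p, hp⟩ := hs.isPauli T hT
      refine hp.mul_comm_of_comm_eq_zero hS ((ZMod.eq_zero_or_eq_one _).resolve_right fun h1 => ?_)
      exact hcomm T hT (hp.mul_comm_of_comm_eq_one hS h1)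
    refine ⟨fun T hT => ?_, fun T hT => ?_, fun T hT T' hT' => ?_⟩
    · rcases List.mem_append.1 hT with hT | hT
      · exact hs.isPauli T hT
      · rw [List.mem_singleton.1 hT]
        exact ⟨_, hS⟩
    · rcases List.mem_append.1 hT with hT | hT
      · exact hs.mul_self T hT
      · rw [List.mem_singleton.1 hT]
        exact (C.measured j).op_mul_self
    · rcases List.mem_append.1 hT with hT | hT <;> rcases List.mem_append.1 hT' with hT' | hT'
      · exact hs.commute T hT T' hT'
      · rw [List.mem_singleton.1 hT']
        exact hc T hT
      · rw [List.mem_singleton.1 hT]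
        exact (hc T' hT').symm
      · rw [List.mem_singleton.1 hT, List.mem_singleton.1 hT']
  | anticommuting j _ hplus hminus L₁ L₂ T hgens hT =>
    classical
    set S := (C.measured j).op with hSdef
    have hS : IsPauliWithClass S _ := (C.measured j).isPauliWithClass_op
    have hTm : T ∈ s.gens := by rw [hgens]; simp
    have hsub : ∀ T' ∈ L₁ ++ L₂, T' ∈ s.gens := by
      intro T' hT'
      rw [hgens]
      simp only [List.mem_append, List.mem_cons] at hT' ⊢
      tauto
    -- The product of two operators that anticommute with `S` commutes with `S`, so everything in
    -- the new list is compatible with `S`.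
    have hmem : ∀ R ∈ ((L₁ ++ L₂).map fun T' =>
            if T'.1 * S = -(S * T'.1) then (T.1 * T'.1, T.2 + T'.2) else T') ++
              [(S, Pi.single j 1)],
        (R.1 = S ∨ (∃ T' ∈ s.gens, R.1 = T.1 * T'.1 ∧ Commute R.1 S) ∨
          (R ∈ s.gens ∧ Commute R.1 S)) := by
      intro R hR
      rcases List.mem_append.1 hR with hR | hR
      · obtain ⟨T', hT', rfl⟩ := List.mem_map.1 hR
        by_cases hc : T'.1 * S = -(S * T'.1)
        · refine Or.inr (Or.inl ⟨T', hsub T' hT', ?_⟩)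
          rw [if_pos hc]
          refine ⟨rfl, ?_⟩
          change T.1 * T'.1 * S = S * (T.1 * T'.1)
          rw [mul_assoc, hc, mul_neg, ← mul_assoc, hT, neg_mul, neg_neg, mul_assoc]
        · refine Or.inr (Or.inr ?_)
          rw [if_neg hc]
          obtain ⟨p, hp⟩ := hs.isPauli T' (hsub T' hT')
          exact ⟨hsub T' hT', hp.mul_comm_of_comm_eq_zero hS
            ((ZMod.eq_zero_or_eq_one _).resolve_right fun h1 =>
              hc (hp.mul_comm_of_comm_eq_one hS h1))⟩
      · rw [List.mem_singleton.1 hR]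
        exact Or.inl rfl
    refine ⟨fun R hR => ?_, fun R hR => ?_, fun R hR R' hR' => ?_⟩
    · rcases hmem R hR with h | ⟨T', hT', h, -⟩ | ⟨h, -⟩
      · rw [h]; exact ⟨_, hS⟩
      · obtain ⟨p, hp⟩ := hs.isPauli T hTm
        obtain ⟨q, hq⟩ := hs.isPauli T' hT'
        rw [h]
        exact ⟨_, hp.mul hq⟩
      · exact hs.isPauli R h
    · rcases hmem R hR with h | ⟨T', hT', h, -⟩ | ⟨h, -⟩
      · rw [h]; exact (C.measured j).op_mul_self
      · rw [h, mul_assoc, ← mul_assoc T'.1, (hs.commute T' hT' T hTm).eq, mul_assoc,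
          hs.mul_self T' hT', mul_one, hs.mul_self T hTm]
      · exact hs.mul_self R h
    · have hRT : ∀ T' ∈ s.gens, ∀ T'' ∈ s.gens, Commute (T.1 * T'.1) T''.1 :=
        fun T' hT' T'' hT'' => (hs.commute T hTm T'' hT'').mul_left (hs.commute T' hT' T'' hT'')
      rcases hmem R hR with h | ⟨T₁, hT₁, h, hc⟩ | ⟨h, hc⟩ <;>
        rcases hmem R' hR' with h' | ⟨T₂, hT₂, h', hc'⟩ | ⟨h', hc'⟩
      · rw [h, h']
      · rw [h]; exact hc'.symm
      · rw [h]; exact hc'.symm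
      · rw [h']; exact hc
      · rw [h, h']
        exact (hRT T₁ hT₁ T hTm).mul_right (hRT T₁ hT₁ T₂ hT₂)
      · rw [h]; exact hRT T₁ hT₁ R' h'
      · rw [h']; exact hc
      · rw [h']; exact (hRT T₂ hT₂ R h).symm
      · exact hs.commute R h R' h'

/-- The outcomes `o` satisfy the checks found so far. -/
def CheckState.Sat (s : C.CheckState) (o : C.Meas → ZMod 2) : Prop :=
  ∀ c ∈ s.checks, ∑ j, c.1 j * o j = c.2

/-- The operators `ρ o` (the unnormalized states for the outcomes `o` and the maximally mixed input
state) are described by the state of the computation of checks. -/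
structure CheckState.Describes (s : C.CheckState)
    (ρ : (C.Meas → ZMod 2) → Matrix (Fin n → Fin 2) (Fin n → Fin 2) ℂ) : Prop where
  trace_ne_zero : ∀ o, (stabProd o s.gens).trace ≠ 0
  eq_smul : ∀ o, s.Sat o → ∃ c : ℂ, c ≠ 0 ∧ ρ o = c • stabProd o s.gens
  eq_zero : ∀ o, ¬ s.Sat o → ρ o = 0

theorem kraus_measure (o : C.Meas → ZMod 2) (j : C.Meas) :
    C.kraus o j.1 = (C.measured j).projector (o j) := by
  rw [kraus, dif_pos j.2]

theorem kraus_gate (o : C.Meas → ZMod 2) {i : Fin C.size} (hi : ¬ (C.op i).IsMeasurement) :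
    C.kraus o i = (C.op i).unitaryPart.1 := by
  rw [kraus, dif_neg hi]

theorem sum_single_mul (o : C.Meas → ZMod 2) (j : C.Meas) :
    ∑ k, (Pi.single j 1 : C.Meas → ZMod 2) k * o k = o j := by
  classical
  rw [Finset.sum_eq_single j]
  · simp
  · intro k _ hk
    rw [Pi.single_eq_of_ne hk, zero_mul]
  · simp

theorem sat_append_singleton (g g' : List (QubitUnitary n × (C.Meas → ZMod 2)))
    (L : List ((C.Meas → ZMod 2) × ZMod 2)) (c : (C.Meas → ZMod 2) × ZMod 2)
    (o : C.Meas → ZMod 2) :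
    CheckState.Sat (C := C) ⟨g, L ++ [c]⟩ o ↔
      CheckState.Sat (C := C) ⟨g', L⟩ o ∧ ∑ j, c.1 j * o j = c.2 := by
  simp only [CheckState.Sat, List.mem_append, List.mem_singleton, or_imp, forall_and,
    forall_eq]

/-- The measurement of an operator with a known value `b`. -/
theorem CheckState.Describes.known {s : C.CheckState} (hs : IsStabilizerList s.gens)
    {ρ : (C.Meas → ZMod 2) → Matrix (Fin n → Fin 2) (Fin n → Fin 2) ℂ} (hρ : s.Describes ρ)
    (j : C.Meas) (L : List (QubitUnitary n × (C.Meas → ZMod 2))) (hL : ∀ T ∈ L, T ∈ s.gens)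
    (b : ZMod 2) (hprod : (L.map Prod.fst).prod.1 = signOf b • (C.measured j).op.1) :
    CheckState.Describes (C := C) ⟨s.gens, s.checks ++ [(Pi.single j 1 + (L.map Prod.snd).sum, b)]⟩
      fun o => C.kraus o j.1 * ρ o * (C.kraus o j.1).conjTranspose := by
  have hval : ∀ o : C.Meas → ZMod 2,
      ∑ k, (Pi.single j 1 + (L.map Prod.snd).sum : C.Meas → ZMod 2) k * o k =
      o j + ∑ k, (L.map Prod.snd).sum k * o k := by
    intro o
    rw [← sum_single_mul o j, ← Finset.sum_add_distrib]
    exact Finset.sum_congr rfl fun k _ => by rw [Pi.add_apply, add_mul]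
  -- The measured operator is, up to the sign given by `b`, a product of generators, so it acts on
  -- `stabProd` as a sign determined by the earlier outcomes.
  have hSP : ∀ o, (C.measured j).op.1 * stabProd o s.gens =
      signOf (b + ∑ k, (L.map Prod.snd).sum k * o k) • stabProd o s.gens := by
    intro o
    have h := hs.prod_mul_stabProd o hL
    rw [hprod, Matrix.smul_mul] at h
    have h2 := congrArg (fun A => signOf b • A) h
    simp only [smul_smul, signOf_mul_self, one_smul] at h2
    rw [h2, signOf_add]
  -- The scalar is `1` if `o` satisfies the new check and `0` otherwise: the projector either
  -- changes nothing or annihilates the state.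
  have hP : ∀ o, C.kraus o j.1 * stabProd o s.gens =
      ((1 / 2 : ℂ) * (1 + signOf (o j + (b + ∑ k, (L.map Prod.snd).sum k * o k)))) •
        stabProd o s.gens := by
    intro o
    rw [kraus_measure, MeasuredPauli.projector_eq, Matrix.smul_mul, add_mul, one_mul,
      Matrix.smul_mul, hSP, mul_smul (1 / 2 : ℂ), add_smul, one_smul, signOf_add (o j), mul_smul]
  have hcomm : ∀ o, Commute (C.kraus o j.1) (stabProd o s.gens) := by
    intro o
    have h : ∀ T ∈ s.gens, Commute (C.measured j).op.1 T.1.1 := by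
      intro T hT
      have h1 : Commute (L.map Prod.fst).prod T.1 := Commute.list_prod_left _ _ fun U hU => by
        obtain ⟨T', hT', rfl⟩ := List.mem_map.1 hU
        exact hs.commute T' (hL T' hT') T hT
      have h2 : (C.measured j).op.1 = signOf b • (L.map Prod.fst).prod.1 := by
        rw [hprod, smul_smul, signOf_mul_self, one_smul]
      rw [h2]
      exact h1.coe_unitary.smul_left _
    rw [kraus_measure, MeasuredPauli.projector_eq]
    exact ((Commute.one_left _).add_left ((commute_stabProd o h).smul_left _)).smul_left _
  have hherm : ∀ o, (C.kraus o j.1).conjTranspose = C.kraus o j.1 := fun o => by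
    rw [kraus_measure, MeasuredPauli.conjTranspose_projector]
  refine ⟨hρ.trace_ne_zero, fun o ho => ?_, fun o ho => ?_⟩
  · obtain ⟨ho₁, ho₂⟩ := (sat_append_singleton s.gens s.gens s.checks _ o).1 ho
    obtain ⟨c, hc, hρo⟩ := hρ.eq_smul o ho₁
    refine ⟨c, hc, ?_⟩
    rw [hval] at ho₂
    have h1 : o j + (b + ∑ k, (L.map Prod.snd).sum k * o k) = 0 := by
      rw [add_left_comm, ho₂]; exact CharTwo.add_self_eq_zero b
    have hP' : C.kraus o j.1 * stabProd o s.gens = stabProd o s.gens := by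
      rw [hP, h1]; norm_num
    rw [hρo, Matrix.mul_smul, Matrix.smul_mul, hP', hherm, ← (hcomm o).eq, hP']
  · by_cases ho₁ : s.Sat o
    · obtain ⟨c, hc, hρo⟩ := hρ.eq_smul o ho₁
      have ho₂ : o j + ∑ k, (L.map Prod.snd).sum k * o k ≠ b := fun h =>
        ho ((sat_append_singleton s.gens s.gens s.checks _ o).2 ⟨ho₁, (hval o).trans h⟩)
      have h1 : o j + (b + ∑ k, (L.map Prod.snd).sum k * o k) = 1 := by
        refine (ZMod.eq_zero_or_eq_one _).resolve_left fun h => ho₂ ?_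
        rw [add_left_comm] at h
        exact (CharTwo.add_eq_zero.1 h).symm
      have hP' : C.kraus o j.1 * stabProd o s.gens = 0 := by
        rw [hP, h1]; norm_num
      rw [hρo, Matrix.mul_smul, Matrix.smul_mul, hP', zero_mul, smul_zero]
    · rw [hρ.eq_zero o ho₁, mul_zero, zero_mul]

/-- A gate conjugates the product, and a measurement of an operator with a known value keeps or
annihilates it. Otherwise both outcomes are possible: `stabProd` times `S_j` has trace zero, so
projecting onto either eigenspace leaves a non-zero operator, described by the new generators. -/
theorem CheckStep.describes {i : Fin C.size} {s s' : C.CheckState} (h : C.CheckStep i s s')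
    (hs : IsStabilizerList s.gens)
    {ρ : (C.Meas → ZMod 2) → Matrix (Fin n → Fin 2) (Fin n → Fin 2) ℂ} (hρ : s.Describes ρ) :
    s'.Describes fun o => C.kraus o i * ρ o * (C.kraus o i).conjTranspose := by
  have hs' := h.isStabilizerList hs
  cases h with
  | gate _ hi =>
    set U := (C.op i).unitaryPart with hU
    have hk : ∀ o, C.kraus o i = U.1 := fun o => kraus_gate o hi
    have hinv : (U⁻¹).1 = (U.1).conjTranspose := rfl
    have hUU : (U⁻¹).1 * U.1 = 1 := congrArg Subtype.val (inv_mul_cancel U)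
    refine ⟨fun o => ?_, fun o ho => ?_, fun o ho => ?_⟩
    · change (stabProd o (s.gens.map fun T => (U * T.1 * U⁻¹, T.2))).trace ≠ 0
      rw [stabProd_map_conj, Matrix.trace_mul_comm, ← mul_assoc, hUU, one_mul]
      exact hρ.trace_ne_zero o
    · obtain ⟨c, hc, hρo⟩ := hρ.eq_smul o ho
      refine ⟨c, hc, ?_⟩
      change _ = c • stabProd o (s.gens.map fun T => (U * T.1 * U⁻¹, T.2))
      rw [stabProd_map_conj, hk, hρo, Matrix.mul_smul, Matrix.smul_mul, hinv]
    · rw [hρ.eq_zero o ho, mul_zero, zero_mul]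
  | plus j _ L hL hprod =>
    exact hρ.known hs j L hL 0 (by rw [hprod, signOf_zero, one_smul])
  | minus j _ L hL hprod =>
    exact hρ.known hs j L hL 1 (by rw [hprod, signOf_one, neg_one_smul]; rfl)
  | commuting j _ hplus hminus hcomm =>
    have hc : ∀ T ∈ s.gens, Commute (C.measured j).op T.1 := fun T hT =>
      hs'.commute ((C.measured j).op, Pi.single j 1) (by simp) T (List.mem_append_left _ hT)
    have hnew : ∀ o, stabProd o (s.gens ++ [((C.measured j).op, Pi.single j 1)]) =
        stabProd o s.gens * (1 + signOf (o j) • (C.measured j).op.1) := fun o => by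
      rw [stabProd_append, stabProd_singleton, sum_single_mul]
    refine ⟨fun o => ?_, fun o ho => ?_, fun o ho => ?_⟩
    · rw [hnew, mul_add, mul_one, Matrix.mul_smul, Matrix.trace_add, Matrix.trace_smul,
        hs.trace_stabProd_mul_eq_zero o (C.measured j).isPauliWithClass_op
          (C.measured j).op_mul_self hc hplus hminus, smul_zero, add_zero]
      exact hρ.trace_ne_zero o
    · obtain ⟨c, hc', hρo⟩ := hρ.eq_smul o ho
      refine ⟨c * (1 / 2), mul_ne_zero hc' (by norm_num), ?_⟩
      have hPc : Commute (C.kraus o j.1) (stabProd o s.gens) := by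
        rw [kraus_measure, MeasuredPauli.projector_eq]
        exact ((Commute.one_left _).add_left ((commute_stabProd o fun T hT =>
          (hc T hT).coe_unitary).smul_left _)).smul_left _
      rw [hρo, Matrix.mul_smul, Matrix.smul_mul, hPc.eq, mul_assoc, hnew, mul_smul]
      rw [kraus_measure, MeasuredPauli.conjTranspose_projector, MeasuredPauli.projector_mul_self,
        MeasuredPauli.projector_eq, Matrix.mul_smul]
    · rw [hρ.eq_zero o ho, mul_zero, zero_mul]
  | anticommuting j _ hplus hminus L₁ L₂ T hgens hT =>
    classical
    set S := (C.measured j).op with hSdef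
    have hTm : T ∈ s.gens := by rw [hgens]; simp
    have hsub : ∀ T' ∈ L₁ ++ L₂, T' ∈ s.gens := by
      intro T' hT'
      rw [hgens]
      simp only [List.mem_append, List.mem_cons] at hT' ⊢
      tauto
    set L' := (L₁ ++ L₂).map fun T' =>
      if T'.1 * S = -(S * T'.1) then (T.1 * T'.1, T.2 + T'.2) else T' with hL'
    have hTS : T.1.1 * S.1 = -(S.1 * T.1.1) := congrArg Subtype.val hT
    have hnew : ∀ o, stabProd o (L' ++ [(S, Pi.single j 1)]) =
        stabProd o L' * (1 + signOf (o j) • S.1) := fun o => by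
      rw [stabProd_append, stabProd_singleton, sum_single_mul]
    -- In the presence of the factor for `T`, the old generators may be replaced by the updated
    -- ones, which commute with `S`.
    have hold : ∀ o, stabProd o s.gens =
        stabProd o L' * (1 + signOf (∑ k, T.2 k * o k) • T.1.1) := by
      intro o
      refine Eq.trans ?_ (stabProd_map_ite_mul o T (hs.mul_self T hTm)
        (fun T' => T'.1 * S = -(S * T'.1)) fun T' hT' => hs.commute T hTm T' (hsub T' hT')).symm
      rw [hgens, stabProd_append, stabProd_append, stabProd_cons, mul_assoc]
      congr 1
      refine ((Commute.one_left _).add_left ((commute_stabProd o fun T' hT' => ?_).smul_left _)).eq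
      exact (hs.commute T hTm T' (hsub T' (List.mem_append_right _ hT'))).coe_unitary
    have hSc : ∀ o, Commute S.1 (stabProd o L') := fun o => commute_stabProd o fun T' hT' =>
      (hs'.commute (S, Pi.single j 1) (by simp) T' (List.mem_append_left _ hT')).coe_unitary
    have hPc : ∀ o, Commute ((C.measured j).projector (o j)) (stabProd o L') := fun o => by
      rw [MeasuredPauli.projector_eq]
      exact ((Commute.one_left _).add_left ((hSc o).smul_left _)).smul_left _
    -- Since `T` anticommutes with `S`, it exchanges the two eigenspaces of `S`. Hence only the term
    -- `1` of `1 ± T` survives between the projectors.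
    have hPTP : ∀ o : C.Meas → ZMod 2,
        (C.measured j).projector (o j) * T.1.1 * (C.measured j).projector (o j) = 0 := by
      intro o
      have h1 : (C.measured j).projector (o j) * T.1.1 =
          T.1.1 * ((1 / 2 : ℂ) • (1 - signOf (o j) • S.1)) := by
        rw [MeasuredPauli.projector_eq, Matrix.smul_mul, add_mul, one_mul, Matrix.smul_mul,
          ← hSdef, ← neg_eq_iff_eq_neg.2 hTS, Matrix.mul_smul, mul_sub, mul_one, Matrix.mul_smul,
          smul_neg, sub_eq_add_neg]
      rw [h1, mul_assoc, Matrix.smul_mul, sub_mul, one_mul, Matrix.smul_mul,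
        MeasuredPauli.op_mul_projector, smul_smul, signOf_mul_self, one_smul, sub_self, smul_zero,
        mul_zero]
    have hPPP : ∀ o, (C.measured j).projector (o j) * stabProd o s.gens *
        (C.measured j).projector (o j) = (1 / 2 : ℂ) • stabProd o (L' ++ [(S, Pi.single j 1)]) := by
      intro o
      rw [hold, ← mul_assoc, (hPc o).eq, mul_assoc, mul_assoc, hnew, add_mul, one_mul, mul_add,
        MeasuredPauli.projector_mul_self, Matrix.smul_mul, Matrix.mul_smul, ← mul_assoc _ T.1.1,
        hPTP, smul_zero, add_zero, MeasuredPauli.projector_eq, Matrix.mul_smul]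
    refine ⟨fun o => ?_, fun o ho => ?_, fun o ho => ?_⟩
    -- Absorbing `T` into `stabProd` costs only a sign, and moving it around the trace past `S`
    -- gives an extra factor `-1`, so the trace equals its own negative.
    · have h1 : (S.1 * stabProd o s.gens).trace = 0 := by
        have hee := signOf_mul_self (∑ k, T.2 k * o k)
        set e := signOf (∑ k, T.2 k * o k)
        have hTP : T.1.1 * stabProd o s.gens = e • stabProd o s.gens := hs.mul_stabProd o hTm
        have hPT : stabProd o s.gens * T.1.1 = e • stabProd o s.gens := by
          rw [← hTP]
          exact (commute_stabProd o fun T' hT' =>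
            (hs.commute T hTm T' hT').coe_unitary).eq.symm
        have h2 : (S.1 * (T.1.1 * stabProd o s.gens)).trace =
            -(S.1 * (T.1.1 * stabProd o s.gens)).trace := by
          conv_lhs => rw [hTP, ← hPT, ← mul_assoc, Matrix.trace_mul_comm, ← mul_assoc, hTS,
            neg_mul, Matrix.trace_neg, mul_assoc]
        have h3 := self_eq_neg.1 h2
        rw [hTP, Matrix.mul_smul, Matrix.trace_smul, smul_eq_mul] at h3
        refine (mul_eq_zero.1 h3).resolve_left fun h => ?_
        rw [h, mul_zero] at hee
        exact zero_ne_one hee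
      -- By cyclicity the trace of `P Π P` is that of `P Π`, which is half the trace of `Π` because
      -- the part with `S` vanishes.
      have h2 := congrArg Matrix.trace (hPPP o)
      rw [Matrix.trace_mul_comm, ← mul_assoc, MeasuredPauli.projector_mul_self,
        MeasuredPauli.projector_eq, Matrix.smul_mul, add_mul, one_mul, Matrix.smul_mul,
        Matrix.trace_smul, Matrix.trace_add, Matrix.trace_smul, h1, smul_zero, add_zero,
        Matrix.trace_smul] at h2
      intro h0
      change (stabProd o (L' ++ [(S, Pi.single j 1)])).trace = 0 at h0
      rw [h0, smul_zero, smul_eq_mul] at h2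
      exact mul_ne_zero (by norm_num) (hρ.trace_ne_zero o) h2
    · obtain ⟨c, hc, hρo⟩ := hρ.eq_smul o ho
      refine ⟨c * (1 / 2), mul_ne_zero hc (by norm_num), ?_⟩
      change _ = (c * (1 / 2)) • stabProd o (L' ++ [(S, Pi.single j 1)])
      rw [hρo, Matrix.mul_smul, Matrix.smul_mul, kraus_measure,
        MeasuredPauli.conjTranspose_projector, hPPP, smul_smul]
    · rw [hρ.eq_zero o ho, mul_zero, zero_mul]

end CliffordCircuit

namespace CliffordCircuit

variable {n : ℕ} (C : CliffordCircuit n)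

/-! ### Forward accumulation of measured operators -/

open Classical in
/-- The product of the operators `S_j ^ (w j)` over the measurements among the first `t` operations,
each of them conjugated by the gates that come after it. -/
noncomputable def accum : ℕ → ((C.Meas → ZMod 2) →ₗ[ZMod 2] PauliBar (Fin n))
  | 0 => 0
  | t + 1 =>
    if ht : t < C.size then
      if h : (C.op ⟨t, ht⟩).IsMeasurement then
        accum t + (LinearMap.proj (⟨⟨t, ht⟩, h⟩ : C.Meas)).smulRight (C.measured ⟨⟨t, ht⟩, h⟩).pauli
      else (conjInvHom _ (isClifford_unitaryPart (C.op ⟨t, ht⟩)).inv).comp (accum t)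
    else accum t

theorem accum_succ_measure (j : C.Meas) (w : C.Meas → ZMod 2) :
    C.accum (j.1 + 1) w = C.accum j.1 w + w j • (C.measured j).pauli := by
  rw [accum, dif_pos j.1.2, dif_pos j.2]
  rfl

/-- `conjInv` of an inverse is forward conjugation `p ↦ U p U⁻¹`, as in the simulation. -/
theorem accum_succ_gate {i : Fin C.size} (hi : ¬ (C.op i).IsMeasurement) (w : C.Meas → ZMod 2) :
    C.accum (i + 1) w = conjInv (C.op i).unitaryPart⁻¹ (C.accum i w) := by
  rw [accum, dif_pos i.2, dif_neg hi]
  rfl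

theorem accum_eq_zero {t : ℕ} {w : C.Meas → ZMod 2} (ht : t ≤ C.size)
    (hw : ∀ j : C.Meas, (j.1 : ℕ) < t → w j = 0) : C.accum t w = 0 := by
  induction t with
  | zero => rfl
  | succ t ih =>
    have ih' := ih (by omega) fun j hj => hw j (by omega)
    by_cases h : (C.op ⟨t, ht⟩).IsMeasurement
    · have := C.accum_succ_measure ⟨⟨t, ht⟩, h⟩ w
      rw [hw ⟨⟨t, ht⟩, h⟩ (Nat.lt_succ_self t), zero_smul, add_zero] at this
      exact this.trans ih'
    · have := C.accum_succ_gate h w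
      dsimp only at this
      rw [this, ih', conjInv_zero (isClifford_unitaryPart _).inv]

variable {C}

/-- The vectors that occur in a state of the computation of checks. -/
def CheckState.vecs (s : C.CheckState) : Set (C.Meas → ZMod 2) :=
  {w | (∃ T, (T, w) ∈ s.gens) ∨ ∃ b, (w, b) ∈ s.checks}

/-- The properties of the state of the computation of checks after `t` operations. -/
structure CheckState.Valid (t : ℕ) (s : C.CheckState) : Prop where
  isStabilizerList : IsStabilizerList s.gens
  isPauliWithClass : ∀ T ∈ s.gens, IsPauliWithClass T.1 (C.accum t T.2)
  accum_check : ∀ c ∈ s.checks, C.accum t c.1 = 0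
  fresh : ∀ w ∈ s.vecs, ∀ j : C.Meas, t ≤ j.1 → w j = 0
  comm_eq_zero : ∀ w ∈ s.vecs, ∀ w' ∈ s.vecs, ∀ t' ≤ t, (C.accum t' w).comm (C.accum t' w') = 0

/-- At the current time, the accumulated operators are the classes of commuting generators, or
trivial in the case of checks. -/
theorem CheckState.Valid.comm_self {t : ℕ} {s : C.CheckState} (hs : IsStabilizerList s.gens)
    (hcls : ∀ T ∈ s.gens, IsPauliWithClass T.1 (C.accum t T.2))
    (hchk : ∀ c ∈ s.checks, C.accum t c.1 = 0) :
    ∀ w ∈ s.vecs, ∀ w' ∈ s.vecs, (C.accum t w).comm (C.accum t w') = 0 := by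
  rintro w (⟨T, hT⟩ | ⟨b, hb⟩) w' hw'
  · rcases hw' with ⟨T', hT'⟩ | ⟨b, hb⟩
    · exact ((hcls _ hT).comm_eq_zero_iff (hcls _ hT')).2 (hs.commute _ hT _ hT')
    · rw [hchk _ hb, PauliBar.comm_symm, PauliBar.comm_zero_left]
  · rw [hchk _ hb, PauliBar.comm_zero_left]

theorem isPauliWithClass_prod {t : ℕ} {L : List (QubitUnitary n × (C.Meas → ZMod 2))}
    (h : ∀ T ∈ L, IsPauliWithClass T.1 (C.accum t T.2)) :
    IsPauliWithClass (L.map Prod.fst).prod (C.accum t (L.map Prod.snd).sum) := by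
  induction L with
  | nil => simpa using isPauliWithClass_one
  | cons T L ih =>
    rw [List.map_cons, List.prod_cons, List.map_cons, List.sum_cons, map_add]
    exact (h T List.mem_cons_self).mul (ih fun T' hT' => h T' (List.mem_cons_of_mem _ hT'))

theorem CheckStep.vecs_gate {i : Fin C.size} {s s' : C.CheckState} (h : C.CheckStep i s s')
    (hi : ¬ (C.op i).IsMeasurement) : s'.vecs ⊆ s.vecs := by
  cases h with
  | gate =>
    rintro w (⟨T, hT⟩ | hb)
    · obtain ⟨T', hT', h⟩ := List.mem_map.1 hT
      have h2 : T'.2 = w := congrArg Prod.snd h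
      exact Or.inl ⟨T'.1, h2 ▸ hT'⟩
    · exact Or.inr hb
  | plus j => exact absurd j.2 hi
  | minus j => exact absurd j.2 hi
  | commuting j => exact absurd j.2 hi
  | anticommuting j => exact absurd j.2 hi

theorem single_add_sum_mem_span {s : C.CheckState} (j : C.Meas)
    {L : List (QubitUnitary n × (C.Meas → ZMod 2))} (hL : ∀ T ∈ L, T ∈ s.gens) :
    Pi.single j 1 + (L.map Prod.snd).sum ∈
      Submodule.span (ZMod 2) (insert (Pi.single j 1) s.vecs) := by
  refine Submodule.add_mem _ (Submodule.subset_span (Set.mem_insert _ _))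
    (list_sum_mem fun w hw => ?_)
  obtain ⟨T, hT, rfl⟩ := List.mem_map.1 hw
  exact Submodule.subset_span (Set.mem_insert_of_mem _ (Or.inl ⟨T.1, hL T hT⟩))

/-- Commutation at past times is bilinear in the vectors, so it passes to the new vectors once they
are known to be combinations of the old ones and of `e_j`. -/
theorem CheckStep.vecs_measure {i : Fin C.size} {s s' : C.CheckState} (h : C.CheckStep i s s')
    (hi : (C.op i).IsMeasurement) : s'.vecs ⊆
      Submodule.span (ZMod 2) (insert (Pi.single (⟨i, hi⟩ : C.Meas) 1) s.vecs) := by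
  have hold : s.vecs ⊆
      Submodule.span (ZMod 2) (insert (Pi.single (⟨i, hi⟩ : C.Meas) 1) s.vecs) :=
    (Set.subset_insert _ _).trans Submodule.subset_span
  cases h with
  | gate _ hi' => exact absurd hi hi'
  | plus j _ L hL =>
    rintro w (hT | ⟨b, hb⟩)
    · exact hold (Or.inl hT)
    · rcases List.mem_append.1 hb with hb | hb
      · exact hold (Or.inr ⟨b, hb⟩)
      · have h2 := congrArg Prod.fst (List.mem_singleton.1 hb)
        dsimp only at h2
        rw [h2]
        exact single_add_sum_mem_span j hL
  | minus j _ L hL =>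
    rintro w (hT | ⟨b, hb⟩)
    · exact hold (Or.inl hT)
    · rcases List.mem_append.1 hb with hb | hb
      · exact hold (Or.inr ⟨b, hb⟩)
      · have h2 := congrArg Prod.fst (List.mem_singleton.1 hb)
        dsimp only at h2
        rw [h2]
        exact single_add_sum_mem_span j hL
  | commuting j =>
    rintro w (⟨T, hT⟩ | hb)
    · rcases List.mem_append.1 hT with hT | hT
      · exact hold (Or.inl ⟨T, hT⟩)
      · have h2 := congrArg Prod.snd (List.mem_singleton.1 hT)
        dsimp only at h2
        rw [h2]
        exact Submodule.subset_span (Set.mem_insert _ _)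
    · exact hold (Or.inr hb)
  | anticommuting j _ hplus hminus L₁ L₂ T hgens hT =>
    have hsub : ∀ T' ∈ L₁ ++ L₂, T' ∈ s.gens := by
      intro T' hT'
      rw [hgens]
      simp only [List.mem_append, List.mem_cons] at hT' ⊢
      tauto
    have hTm : T ∈ s.gens := by rw [hgens]; simp
    rintro w (⟨R, hR⟩ | hb)
    · rcases List.mem_append.1 hR with hR | hR
      · obtain ⟨T', hT', h⟩ := List.mem_map.1 hR
        have h1 := hold (Or.inl ⟨T'.1, hsub T' hT'⟩ : T'.2 ∈ s.vecs)
        have h2 := congrArg Prod.snd h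
        dsimp only at h2
        rw [← h2]
        split_ifs
        · exact Submodule.add_mem _ (hold (Or.inl ⟨T.1, hTm⟩ : T.2 ∈ s.vecs)) h1
        · exact h1
      · have h2 := congrArg Prod.snd (List.mem_singleton.1 hR)
        dsimp only at h2
        rw [h2]
        exact Submodule.subset_span (Set.mem_insert _ _)
    · exact hold (Or.inr hb)

theorem accum_succ_of_fresh {s : C.CheckState} {j : C.Meas}
    (hfresh : ∀ w ∈ s.vecs, ∀ k : C.Meas, (j.1 : ℕ) ≤ k.1 → w k = 0) {w : C.Meas → ZMod 2}
    (hw : w ∈ s.vecs) : C.accum (j.1 + 1) w = C.accum j.1 w := by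
  rw [accum_succ_measure, hfresh w hw j le_rfl, zero_smul, add_zero]

theorem accum_succ_single (j : C.Meas) :
    C.accum (j.1 + 1) (Pi.single j 1) = (C.measured j).pauli := by
  rw [accum_succ_measure, accum_eq_zero C j.1.2.le, Pi.single_eq_same, one_smul, zero_add]
  intro k hk
  exact Pi.single_eq_of_ne (fun h : k = j => by rw [h] at hk; exact lt_irrefl _ hk) _

/-- The classes of the generators and of the checks after one more operation. -/
theorem CheckStep.classes {i : Fin C.size} {s s' : C.CheckState} (h : C.CheckStep i s s')
    (hs : s.Valid i) : (∀ T ∈ s'.gens, IsPauliWithClass T.1 (C.accum (i + 1) T.2)) ∧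
      ∀ c ∈ s'.checks, C.accum (i + 1) c.1 = 0 := by
  cases h with
  | gate _ hi =>
    have hU := isClifford_unitaryPart (C.op i)
    refine ⟨fun T hT => ?_, fun c hc => ?_⟩
    · obtain ⟨T', hT', rfl⟩ := List.mem_map.1 hT
      have h := (hs.isPauliWithClass T' hT').conjInv hU.inv
      rw [inv_inv] at h
      rw [accum_succ_gate C hi]
      exact h
    · rw [accum_succ_gate C hi, hs.accum_check c hc, conjInv_zero hU.inv]
  | plus j _ L hL hprod =>
    have hold : ∀ T ∈ s.gens, IsPauliWithClass T.1 (C.accum (j.1 + 1) T.2) := fun T hT => by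
      rw [accum_succ_of_fresh hs.fresh (Or.inl ⟨T.1, hT⟩)]
      exact hs.isPauliWithClass T hT
    refine ⟨hold, fun c hc => ?_⟩
    rcases List.mem_append.1 hc with hc | hc
    · rw [accum_succ_of_fresh hs.fresh (Or.inr ⟨c.2, hc⟩)]
      exact hs.accum_check c hc
    -- The vector `e_j` contributes the class of `S_j`, and the decomposition of `S_j` contributes
    -- the same class again; they cancel.
    · rw [List.mem_singleton.1 hc, map_add, accum_succ_single]
      have h1 := isPauliWithClass_prod fun T hT => hold T (hL T hT)
      rw [hprod] at h1
      rw [h1.unique (C.measured j).isPauliWithClass_op]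
      exact ZModModule.add_self _
  | minus j _ L hL hprod =>
    have hold : ∀ T ∈ s.gens, IsPauliWithClass T.1 (C.accum (j.1 + 1) T.2) := fun T hT => by
      rw [accum_succ_of_fresh hs.fresh (Or.inl ⟨T.1, hT⟩)]
      exact hs.isPauliWithClass T hT
    refine ⟨hold, fun c hc => ?_⟩
    rcases List.mem_append.1 hc with hc | hc
    · rw [accum_succ_of_fresh hs.fresh (Or.inr ⟨c.2, hc⟩)]
      exact hs.accum_check c hc
    · rw [List.mem_singleton.1 hc, map_add, accum_succ_single]
      have h1 := isPauliWithClass_prod fun T hT => hold T (hL T hT)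
      rw [hprod] at h1
      rw [h1.unique (C.measured j).isPauliWithClass_op.neg]
      exact ZModModule.add_self _
  | commuting j =>
    refine ⟨fun T hT => ?_, fun c hc => ?_⟩
    · rcases List.mem_append.1 hT with hT | hT
      · rw [accum_succ_of_fresh hs.fresh (Or.inl ⟨T.1, hT⟩)]
        exact hs.isPauliWithClass T hT
      · rw [List.mem_singleton.1 hT, accum_succ_single]
        exact (C.measured j).isPauliWithClass_op
    · rw [accum_succ_of_fresh hs.fresh (Or.inr ⟨c.2, hc⟩)]
      exact hs.accum_check c hc
  | anticommuting j _ hplus hminus L₁ L₂ T hgens hT =>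
    have hold : ∀ T ∈ s.gens, IsPauliWithClass T.1 (C.accum (j.1 + 1) T.2) := fun T hT => by
      rw [accum_succ_of_fresh hs.fresh (Or.inl ⟨T.1, hT⟩)]
      exact hs.isPauliWithClass T hT
    have hsub : ∀ T' ∈ L₁ ++ L₂, T' ∈ s.gens := by
      intro T' hT'
      rw [hgens]
      simp only [List.mem_append, List.mem_cons] at hT' ⊢
      tauto
    have hTm : T ∈ s.gens := by rw [hgens]; simp
    refine ⟨fun R hR => ?_, fun c hc => ?_⟩
    · rcases List.mem_append.1 hR with hR | hR
      · obtain ⟨T', hT', rfl⟩ := List.mem_map.1 hR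
        split_ifs
        · rw [map_add]
          exact (hold T hTm).mul (hold T' (hsub T' hT'))
        · exact hold T' (hsub T' hT')
      · rw [List.mem_singleton.1 hR, accum_succ_single]
        exact (C.measured j).isPauliWithClass_op
    · rw [accum_succ_of_fresh hs.fresh (Or.inr ⟨c.2, hc⟩)]
      exact hs.accum_check c hc

theorem comm_accum_eq_zero_of_mem_span {t : ℕ} {V : Set (C.Meas → ZMod 2)}
    (hV : ∀ w ∈ V, ∀ w' ∈ V, (C.accum t w).comm (C.accum t w') = 0) {w w' : C.Meas → ZMod 2}
    (hw : w ∈ Submodule.span (ZMod 2) V) (hw' : w' ∈ Submodule.span (ZMod 2) V) :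
    (C.accum t w).comm (C.accum t w') = 0 := by
  have himage : ∀ {x}, x ∈ Submodule.span (ZMod 2) V →
      C.accum t x ∈ Submodule.span (ZMod 2) (C.accum t '' V) := fun hx => by
    rw [Submodule.span_image]
    exact Submodule.mem_map_of_mem hx
  refine PauliBar.comm_eq_zero_of_mem_span ?_ (himage hw)
  rintro _ ⟨x, hx, rfl⟩
  rw [PauliBar.comm_symm]
  refine PauliBar.comm_eq_zero_of_mem_span ?_ (himage hw')
  rintro _ ⟨x', hx', rfl⟩
  exact hV x' hx' x hx

/-- Commutation is required at all times up to the present one. For past times it follows by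
linearity from the previous state, and for the present time from the commutation of the generators.
-/
theorem CheckStep.valid {i : Fin C.size} {s s' : C.CheckState} (h : C.CheckStep i s s')
    (hs : s.Valid i) : s'.Valid (i + 1) := by
  have hstab := h.isStabilizerList hs.isStabilizerList
  obtain ⟨hcls, hchk⟩ := h.classes hs
  refine ⟨hstab, hcls, hchk, ?_, fun w hw w' hw' t' ht' => ?_⟩
  · by_cases hi : (C.op i).IsMeasurement
    · intro w hw k hk
      have : Submodule.span (ZMod 2) (insert (Pi.single (⟨i, hi⟩ : C.Meas) 1) s.vecs) ≤
          LinearMap.ker (LinearMap.proj k : (C.Meas → ZMod 2) →ₗ[ZMod 2] ZMod 2) := by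
        refine Submodule.span_le.2 fun x hx => ?_
        rcases hx with rfl | hx
        · refine Pi.single_eq_of_ne (fun h : k = ⟨i, hi⟩ => ?_) _
          rw [h] at hk
          exact absurd hk (Nat.not_succ_le_self _)
        · exact hs.fresh x hx k (by omega)
      exact this (h.vecs_measure hi hw)
    · exact fun w hw k hk => hs.fresh w (h.vecs_gate hi hw) k (by omega)
  · rcases Nat.lt_succ_iff_lt_or_eq.1 (Nat.lt_succ_of_le ht') with ht | rfl
    · replace ht : t' ≤ i := by omega
      by_cases hi : (C.op i).IsMeasurement
      · refine comm_accum_eq_zero_of_mem_span ?_ (h.vecs_measure hi hw) (h.vecs_measure hi hw')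
        -- Before the measurement takes place, its own vector has accumulated nothing, so it adds no
        -- condition at past times.
        have hzero : C.accum t' (Pi.single (⟨i, hi⟩ : C.Meas) 1) = 0 := by
          refine C.accum_eq_zero (ht.trans i.2.le) fun k hk => ?_
          refine Pi.single_eq_of_ne (fun h : k = ⟨i, hi⟩ => ?_) _
          rw [h] at hk
          exact absurd hk (not_lt.2 ht)
        rintro x (rfl | hx) y hy
        · rw [hzero, PauliBar.comm_zero_left]
        · rcases hy with rfl | hy
          · rw [hzero, PauliBar.comm_symm, PauliBar.comm_zero_left]
          · exact hs.comm_eq_zero x hx y hy t' ht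
      · exact hs.comm_eq_zero w (h.vecs_gate hi hw) w' (h.vecs_gate hi hw') t' ht
    · exact CheckState.Valid.comm_self hstab hcls hchk w hw w' hw'

theorem CheckState.valid_init : CheckState.Valid (C := C) 0 ⟨[], []⟩ :=
  ⟨⟨by simp, by simp, by simp⟩, by simp, by simp, by simp [CheckState.vecs],
    by simp [CheckState.vecs]⟩

/-- Every operation can be processed. -/
theorem CheckState.Valid.exists_step {i : Fin C.size} {s : C.CheckState} (hs : s.Valid i) :
    ∃ s', C.CheckStep i s s' := by
  by_cases hi : (C.op i).IsMeasurement
  swap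
  · exact ⟨_, CheckStep.gate i hi s⟩
  let j : C.Meas := ⟨i, hi⟩
  by_cases hplus : (C.measured j).op ∈ s.group
  · obtain ⟨L, hL, hprod⟩ := hs.isStabilizerList.exists_prod_eq hplus
    exact ⟨_, CheckStep.plus j s L hL hprod⟩
  by_cases hminus : -(C.measured j).op ∈ s.group
  · obtain ⟨L, hL, hprod⟩ := hs.isStabilizerList.exists_prod_eq hminus
    exact ⟨_, CheckStep.minus j s L hL hprod⟩
  by_cases hcomm : ∀ T ∈ s.gens, T.1 * (C.measured j).op ≠ -((C.measured j).op * T.1)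
  · exact ⟨_, CheckStep.commuting j s hplus hminus hcomm⟩
  · push Not at hcomm
    obtain ⟨T, hT, hanti⟩ := hcomm
    obtain ⟨L₁, L₂, hgens⟩ := List.append_of_mem hT
    exact ⟨_, CheckStep.anticommuting j s hplus hminus L₁ L₂ T hgens hanti⟩

/-! ### Complete runs of the computation of checks -/

theorem drop_finRange {m : ℕ} (i : Fin m) :
    (List.finRange m).drop i = i :: (List.finRange m).drop (i + 1) := by
  rw [List.drop_eq_getElem_cons (by simp)]
  simp

/-- Induction along a run for properties that depend on the number `t` of processed operations; the
operations still to come are those left after dropping `t`. -/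
theorem CheckSteps.invariant {I : ℕ → C.CheckState → Prop}
    (hI : ∀ (i : Fin C.size) s s', I i s → C.CheckStep i s s' → I (i + 1) s') {t : ℕ}
    (ht : t ≤ C.size) {l : List (Fin C.size)} (hl : l = (List.finRange C.size).drop t)
    {s s' : C.CheckState} (h : C.CheckSteps l s s') (hs : I t s) : I C.size s' := by
  induction h generalizing t with
  | nil s =>
    have := congrArg List.length hl
    simp only [List.length_nil, List.length_drop, List.length_finRange] at this
    rwa [show C.size = t by omega]
  | cons i l s s' s'' hstep _ ih =>
    have hlt : t < C.size := by
      by_contra hge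
      rw [List.drop_eq_nil_of_le (by simpa using hge)] at hl
      exact List.cons_ne_nil _ _ hl
    rw [drop_finRange ⟨t, hlt⟩] at hl
    obtain ⟨rfl, rfl⟩ := List.cons.inj hl
    exact ih hlt rfl (hI _ _ _ hs hstep)

theorem exists_checkSteps {t : ℕ} (ht : t ≤ C.size) {s : C.CheckState} (hs : s.Valid t) :
    ∃ s', C.CheckSteps ((List.finRange C.size).drop t) s s' := by
  induction hk : C.size - t generalizing t s with
  | zero =>
    rw [List.drop_eq_nil_of_le (by simp; omega)]
    exact ⟨s, .nil s⟩
  | succ k ih =>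
    have hlt : t < C.size := by omega
    obtain ⟨s', hs'⟩ := CheckState.Valid.exists_step (i := ⟨t, hlt⟩) hs
    obtain ⟨s'', hs''⟩ := ih hlt (hs'.valid hs) (by omega)
    rw [drop_finRange ⟨t, hlt⟩]
    exact ⟨s'', .cons _ _ _ _ _ hs' hs''⟩

variable (C) in
theorem exists_checkRun : ∃ R, C.CheckRun R := by
  obtain ⟨s, hs⟩ := exists_checkSteps (Nat.zero_le C.size) CheckState.valid_init
  exact ⟨_, s, hs, rfl⟩

theorem CheckRun.accum_eq_zero {R : List ((C.Meas → ZMod 2) × ZMod 2)} (h : C.CheckRun R) :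
    ∀ c ∈ R, C.accum C.size c.1 = 0 := by
  obtain ⟨s, hs, rfl⟩ := h
  exact (hs.invariant (I := fun t s => s.Valid t) (fun i s s' h h' => h'.valid h) (Nat.zero_le _)
    rfl CheckState.valid_init).accum_check

theorem CheckRun.comm_eq_zero {R : List ((C.Meas → ZMod 2) × ZMod 2)} (h : C.CheckRun R) :
    ∀ c ∈ R, ∀ c' ∈ R, ∀ t ≤ C.size, (C.accum t c.1).comm (C.accum t c'.1) = 0 := by
  obtain ⟨s, hs, rfl⟩ := h
  have hv := hs.invariant (I := fun t s => s.Valid t) (fun i s s' h h' => h'.valid h)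
    (Nat.zero_le _) rfl CheckState.valid_init
  exact fun c hc c' hc' => hv.comm_eq_zero _ (Or.inr ⟨c.2, hc⟩) _ (Or.inr ⟨c'.2, hc'⟩)

/-! ### The outcome code and its dual -/

/-- The operator applied by the first `t` operations. -/
noncomputable def krausPrefix (o : C.Meas → ZMod 2) (t : ℕ) :
    Matrix (Fin n → Fin 2) (Fin n → Fin 2) ℂ :=
  (((List.finRange C.size).take t).reverse.map (C.kraus o)).prod

theorem krausPrefix_succ (o : C.Meas → ZMod 2) (i : Fin C.size) :
    krausPrefix o (i + 1) = C.kraus o i * krausPrefix o i := by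
  rw [krausPrefix, ← List.take_append_getElem (by simp)]
  simp [krausPrefix]

theorem krausPrefix_size (o : C.Meas → ZMod 2) : krausPrefix o C.size = C.totalKraus o := by
  rw [krausPrefix, List.take_of_length_le (by simp), totalKraus]

open scoped ComplexOrder in
-- A matrix `K` is zero exactly when `K Kᴴ` is, and `K Kᴴ` is what the final state of the simulation
-- describes.
theorem CheckRun.totalKraus_ne_zero_iff {R : List ((C.Meas → ZMod 2) × ZMod 2)}
    (h : C.CheckRun R) (o : C.Meas → ZMod 2) :
    C.totalKraus o ≠ 0 ↔ ∀ c ∈ R, ∑ j, c.1 j * o j = c.2 := by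
  obtain ⟨s, hs, rfl⟩ := h
  have hd := (hs.invariant (I := fun t s => s.Valid t ∧
      s.Describes fun o => krausPrefix o t * (krausPrefix o t).conjTranspose)
    (fun i s s' h h' => ⟨h'.valid h.1, by
      have := h'.describes h.1.isStabilizerList h.2
      convert this using 2 with o
      rw [krausPrefix_succ, Matrix.conjTranspose_mul]
      simp only [mul_assoc]⟩) (Nat.zero_le _) rfl
    -- Without operations the state is the identity, which is the empty product of stabilizer
    -- factors, and there is no check to violate.
    ⟨CheckState.valid_init, fun o => by rw [stabProd_nil]; exact trace_one_ne_zero,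
      fun o _ => ⟨1, one_ne_zero, by simp [krausPrefix, stabProd_nil]⟩,
      fun o ho => absurd (by simp [CheckState.Sat]) ho⟩).2
  constructor
  · intro hK
    by_contra hsat
    have := hd.eq_zero o hsat
    rw [krausPrefix_size] at this
    exact hK (Matrix.self_mul_conjTranspose_eq_zero.1 this)
  · intro hsat hK
    obtain ⟨c, hc, hρ⟩ := hd.eq_smul o hsat
    rw [krausPrefix_size, hK, zero_mul] at hρ
    have := congrArg Matrix.trace hρ
    rw [Matrix.trace_zero, Matrix.trace_smul, smul_eq_mul] at this
    exact mul_ne_zero hc (hd.trace_ne_zero o) this.symm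

variable (C) in
open scoped ComplexOrder in
theorem mem_outcomeCode_iff (o : C.Meas → ZMod 2) : o ∈ C.outcomeCode ↔ C.totalKraus o ≠ 0 := by
  constructor
  · rintro ⟨ρ, -, -, h⟩ h0
    apply h
    rw [outcomeProb, h0, zero_mul, zero_mul, Matrix.trace_zero, Complex.zero_re]
  · intro h
    set d : ℂ := (1 : Matrix (Fin n → Fin 2) (Fin n → Fin 2) ℂ).trace with hd
    have hd' : d = ((Fintype.card (Fin n → Fin 2) : ℝ) : ℂ) := by
      rw [hd, Matrix.trace_one]; norm_cast
    have hpos : (0 : ℝ) < (Fintype.card (Fin n → Fin 2) : ℝ) := by exact_mod_cast Fintype.card_pos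
    -- For the maximally mixed input the probability of `o` is the trace of `K Kᴴ` divided by `d`,
    -- which vanishes only if `K = 0`. One input state thus witnesses the whole code.
    refine ⟨d⁻¹ • 1, ?_, ?_, ?_⟩
    · refine Matrix.PosSemidef.one.smul ?_
      rw [hd', ← Complex.ofReal_inv]
      exact_mod_cast (inv_pos.2 hpos).le
    · rw [Matrix.trace_smul, smul_eq_mul, ← hd, inv_mul_cancel₀ trace_one_ne_zero]
    · have hps : (C.totalKraus o * (C.totalKraus o).conjTranspose).PosSemidef :=
        Matrix.posSemidef_self_mul_conjTranspose _
      have htr : (C.totalKraus o * (C.totalKraus o).conjTranspose).trace ≠ 0 := fun h0 =>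
        h (Matrix.trace_mul_conjTranspose_self_eq_zero_iff.1 h0)
      have him : (C.totalKraus o * (C.totalKraus o).conjTranspose).trace.im = 0 :=
        ((Complex.le_def.1 hps.trace_nonneg).2).symm
      rw [outcomeProb, Matrix.mul_smul, mul_one, Matrix.smul_mul, Matrix.trace_smul, hd',
        ← Complex.ofReal_inv, smul_eq_mul, Complex.re_ofReal_mul]
      refine mul_ne_zero (inv_pos.2 hpos).ne' fun hre => htr (Complex.ext hre him)

/-- The vectors of the checks generate the dual of a linear outcome code. -/
theorem CheckRun.outcomeDual_eq_span {R : List ((C.Meas → ZMod 2) × ZMod 2)} (h : C.CheckRun R)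
    (hlin : C.HasLinearOutcomeCode) :
    C.outcomeDual = Submodule.span (ZMod 2) {u | ∃ b, (u, b) ∈ R} := by
  have hmem : ∀ o, o ∈ C.outcomeCode ↔ ∀ c ∈ R, ∑ j, c.1 j * o j = c.2 := fun o =>
    (C.mem_outcomeCode_iff o).trans (h.totalKraus_ne_zero_iff o)
  obtain ⟨W, hW⟩ := hlin
  -- A linear code contains `0`, and evaluating the check at `0` gives its constant.
  have hzero : ∀ c ∈ R, c.2 = 0 := by
    intro c hc
    have h0 : (0 : C.Meas → ZMod 2) ∈ C.outcomeCode := hW ▸ W.zero_mem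
    have := (hmem 0).1 h0 c hc
    simpa using this.symm
  have hdot : ∀ f : (C.Meas → ZMod 2) →ₗ[ZMod 2] ZMod 2, ∃ o : C.Meas → ZMod 2,
      ∀ u, f u = ∑ j, u j * o j := by
    classical
    intro f
    refine ⟨fun j => f (Pi.single j 1), fun u => ?_⟩
    conv_lhs => rw [← Finset.univ_sum_single u, map_sum]
    refine Finset.sum_congr rfl fun j _ => ?_
    rw [← smul_eq_mul, ← map_smul, ← Pi.single_smul, smul_eq_mul, mul_one]
  ext u
  constructor
  -- A functional vanishing on the check vectors is the pairing with an outcome string that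
  -- satisfies all checks, that is, with a codeword, so it vanishes on every dual vector.
  · intro hu
    refine mem_span_of_forall_functional fun f hf => ?_
    obtain ⟨o, ho⟩ := hdot f
    rw [ho]
    refine hu o ((hmem o).2 fun c hc => ?_)
    rw [← ho, hf c.1 ⟨c.2, hc⟩, hzero c hc]
  · intro hu o ho
    let φ : (C.Meas → ZMod 2) →ₗ[ZMod 2] ZMod 2 :=
      ∑ j, o j • (LinearMap.proj j : (C.Meas → ZMod 2) →ₗ[ZMod 2] ZMod 2)
    have hφ : ∀ x, φ x = ∑ j, x j * o j := fun x => by simp [φ, mul_comm]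
    have hle : Submodule.span (ZMod 2) {u | ∃ b, (u, b) ∈ R} ≤ LinearMap.ker φ := by
      refine Submodule.span_le.2 ?_
      rintro x ⟨b, hb⟩
      change φ x = 0
      rw [hφ, (hmem o).1 ho _ hb, hzero _ hb]
    rw [← hφ]
    exact hle hu

end CliffordCircuit

namespace CliffordCircuit

variable {n : ℕ} (C : CliffordCircuit n)

/-! ### Back-cumulants -/

theorem isClifford_levelUnitary (ℓ : ℕ) : IsClifford (C.levelUnitary ℓ) := by
  rw [levelUnitary]
  generalize (List.finRange C.size).reverse = l
  induction l with
  | nil => exact IsClifford.one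
  | cons i l ih =>
    rw [List.map_cons, List.prod_cons]
    refine IsClifford.mul ?_ ih
    split_ifs
    exacts [isClifford_unitaryPart _, IsClifford.one]

/-- One step of the computation of a back-cumulant. -/
noncomputable def backStep (k : Fin C.depth) :
    PauliBar C.FaultQubit →+ PauliBar C.FaultQubit where
  toFun G := G + C.eta k.castSucc (conjInv (C.levelUnitary (k + 1)) (C.slice G k.succ))
  map_zero' := by
    change 0 + C.eta k.castSucc (conjInv (C.levelUnitary (k + 1)) 0) = 0
    rw [conjInv_zero (C.isClifford_levelUnitary _), zero_add]
    funext x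
    simp [eta]
  map_add' G H := by
    change G + H + C.eta k.castSucc (conjInv (C.levelUnitary (k + 1))
      (C.slice G k.succ + C.slice H k.succ)) = _
    rw [conjInv_add (C.isClifford_levelUnitary _)]
    funext x
    simp only [Pi.add_apply, eta]
    split_ifs
    · exact add_add_add_comm _ _ _ _
    · simp only [add_zero]

theorem slice_backStep (k : Fin C.depth) (G : PauliBar C.FaultQubit) (x : Fin (C.depth + 1)) :
    C.slice (C.backStep k G) x = C.slice G x +
      if x = k.castSucc then conjInv (C.levelUnitary (k + 1)) (C.slice G k.succ) else 0 := by
  funext q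
  change G (x, q) + C.eta k.castSucc _ (x, q) = _
  rw [eta, Pi.add_apply, slice]
  congr 1
  split_ifs <;> rfl

theorem backCumulant_eq_foldr (F : PauliBar C.FaultQubit) :
    C.backCumulant F = (List.finRange C.depth).foldr (fun k G => C.backStep k G) F := by
  rw [backCumulant, List.foldl_reverse]
  rfl

theorem backCumulant_add (F G : PauliBar C.FaultQubit) :
    C.backCumulant (F + G) = C.backCumulant F + C.backCumulant G := by
  simp only [backCumulant_eq_foldr]
  induction List.finRange C.depth with
  | nil => rfl
  | cons k l ih => simp only [List.foldr_cons, ih, map_add]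

/-- Step `k` changes only slice `k` and reads slice `k + 1`. As larger indices are processed
earlier, the slice read is already final, so the results satisfy a downward recurrence. -/
theorem slice_foldr_backStep (F : PauliBar C.FaultQubit) {l : List (Fin C.depth)}
    (hl : l.Pairwise (· < ·)) :
    (∀ x, (∀ k ∈ l, x ≠ k.castSucc) →
      C.slice (l.foldr (fun k G => C.backStep k G) F) x = C.slice F x) ∧
    ∀ k ∈ l, C.slice (l.foldr (fun k G => C.backStep k G) F) k.castSucc =
      C.slice F k.castSucc + conjInv (C.levelUnitary (k + 1))
        (C.slice (l.foldr (fun k G => C.backStep k G) F) k.succ) := by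
  induction l with
  | nil => simp
  | cons k l ih =>
    obtain ⟨hk, hl⟩ := List.pairwise_cons.1 hl
    obtain ⟨ih₁, ih₂⟩ := ih hl
    have hne : ∀ k' : Fin C.depth, k ≤ k' → k'.succ ≠ k.castSucc := by
      intro k' hkk' h
      have := congrArg Fin.val h
      simp only [Fin.val_succ, Fin.val_castSucc] at this
      have : (k : ℕ) ≤ k' := hkk'
      omega
    simp only [List.foldr_cons, slice_backStep]
    refine ⟨fun x hx => ?_, fun k' hk' => ?_⟩
    · rw [if_neg (hx k List.mem_cons_self), add_zero,
        ih₁ x fun k' hk' => hx k' (List.mem_cons_of_mem _ hk')]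
    · rcases List.mem_cons.1 hk' with rfl | hk'
      · rw [if_pos rfl, if_neg (hne _ le_rfl), add_zero, ih₁ k'.castSucc]
        intro k'' hk'' h
        exact (hk k'' hk'').ne (Fin.castSucc_injective _ h)
      · rw [if_neg fun h => (hk k' hk').ne' (Fin.castSucc_injective _ h), add_zero,
          if_neg (hne _ (hk k' hk').le), add_zero, ih₂ k' hk']

theorem slice_backCumulant_castSucc (F : PauliBar C.FaultQubit) (k : Fin C.depth) :
    C.slice (C.backCumulant F) k.castSucc = C.slice F k.castSucc +
      conjInv (C.levelUnitary (k + 1)) (C.slice (C.backCumulant F) k.succ) := by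
  rw [backCumulant_eq_foldr]
  exact (C.slice_foldr_backStep F (List.pairwise_lt_finRange _)).2 k (List.mem_finRange k)

theorem slice_backCumulant_last (F : PauliBar C.FaultQubit) :
    C.slice (C.backCumulant F) (Fin.last _) = C.slice F (Fin.last _) := by
  rw [backCumulant_eq_foldr]
  exact (C.slice_foldr_backStep F (List.pairwise_lt_finRange _)).1 _
    fun k _ => (Fin.castSucc_lt_last k).ne'

/-- The check operators as a linear map. -/
noncomputable def checkHom : (C.Meas → ZMod 2) →ₗ[ZMod 2] PauliBar C.FaultQubit :=
  AddMonoidHom.toZModLinearMap 2 <| AddMonoidHom.mk' C.checkOperator fun u v => by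
    have h : C.measFault (u + v) = C.measFault u + C.measFault v := by
      rw [measFault, measFault, measFault, ← Finset.sum_add_distrib]
      refine Finset.sum_congr rfl fun j _ => funext fun x => ?_
      simp only [Pi.add_apply, eta, add_smul]
      split_ifs
      · rfl
      · rw [add_zero]
    rw [checkOperator, h, backCumulant_add]
    rfl

@[simp]
theorem checkHom_apply (u : C.Meas → ZMod 2) : C.checkHom u = C.checkOperator u := rfl

theorem slice_measFault (u : C.Meas → ZMod 2) (x : Fin (C.depth + 1)) :
    C.slice (C.measFault u) x =
      ∑ j : C.Meas, if C.level j.1 = x + 1 then u j • (C.measured j).pauli else 0 := by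
  funext q
  rw [slice, measFault, Finset.sum_apply, Finset.sum_apply]
  refine Finset.sum_congr rfl fun j _ => ?_
  -- Levels are at least `1`, so the truncated subtraction in `before` is exact.
  have h : x = C.before j ↔ C.level j.1 = x + 1 := by
    have := C.level_pos j.1
    rw [Fin.ext_iff, before]
    dsimp only
    omega
  simp only [eta, h]
  split_ifs <;> rfl

/-! ### Back-cumulants of checks -/

/-- Distinct operations of one level have disjoint supports, and a measurement has trivial unitary
part. Hence the order of gates and measurements within a level does not matter, which reconciles the
sequential simulation with the levelwise back-cumulant. -/
theorem conjInv_unitaryPart_inv_measured {i : Fin C.size} {j : C.Meas}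
    (h : C.level i = C.level j.1) :
    conjInv (C.op i).unitaryPart⁻¹ (C.measured j).pauli = (C.measured j).pauli := by
  have hU := isClifford_unitaryPart (C.op i)
  suffices h2 : conjInv (C.op i).unitaryPart (C.measured j).pauli = (C.measured j).pauli by
    conv_lhs => rw [← h2]
    exact conjInv_inv_conjInv hU _
  by_cases hij : i = j.1
  · have : (C.op i).unitaryPart = 1 := by
      have hj := j.2
      rw [← hij] at hj
      cases hop : C.op i with
      | gate g => rw [hop] at hj; exact hj.elim
      | measure S => rfl
    rw [this, conjInv_one]
  have hdisj := C.disjoint i j.1 hij h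
  have hq : (C.op j.1).qubits = (C.measured j).pauli.support := by
    have key : ∀ (c : CliffordOperation n) (hc : c.IsMeasurement),
        c.qubits = (c.measured hc).pauli.support := by
      intro c hc
      cases c with
      | gate g => exact hc.elim
      | measure S => rfl
    exact key _ j.2
  rw [hq] at hdisj
  cases hop : C.op i with
  | measure S => exact conjInv_one _
  | gate g =>
    rw [hop] at hdisj
    refine g.actsOn.conjInv_eq g.isClifford fun q hqA => ?_
    by_contra hne
    exact Finset.disjoint_left.1 hdisj hqA (PauliBar.mem_support.2 hne)

/-- The product of the gates with level `ℓ` among the first `r` operations. -/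
noncomputable def levelPrefix (ℓ r : ℕ) : QubitUnitary n :=
  (((List.finRange C.size).take r).reverse.map
    fun i => if C.level i = ℓ then (C.op i).unitaryPart else 1).prod

theorem levelPrefix_succ (ℓ : ℕ) (i : Fin C.size) : C.levelPrefix ℓ (i + 1) =
    (if C.level i = ℓ then (C.op i).unitaryPart else 1) * C.levelPrefix ℓ i := by
  rw [levelPrefix, ← List.take_append_getElem (by simp)]
  simp [levelPrefix]

theorem levelPrefix_size (ℓ : ℕ) : C.levelPrefix ℓ C.size = C.levelUnitary ℓ := by
  rw [levelPrefix, List.take_of_length_le (by simp), levelUnitary]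

theorem isClifford_levelPrefix (ℓ r : ℕ) : IsClifford (C.levelPrefix ℓ r) := by
  rw [levelPrefix]
  generalize ((List.finRange C.size).take r).reverse = l
  induction l with
  | nil => exact IsClifford.one
  | cons i l ih =>
    rw [List.map_cons, List.prod_cons]
    refine IsClifford.mul ?_ ih
    split_ifs
    exacts [isClifford_unitaryPart _, IsClifford.one]

theorem conjInv_levelPrefix_measured (r : ℕ) (hr : r ≤ C.size) (j : C.Meas) :
    conjInv (C.levelPrefix (C.level j.1) r)⁻¹ (C.measured j).pauli = (C.measured j).pauli := by
  induction r with
  | zero =>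
    change conjInv (1 : QubitUnitary n)⁻¹ _ = _
    rw [inv_one, conjInv_one]
  | succ r ih =>
    have h := C.levelPrefix_succ (C.level j.1) ⟨r, hr⟩
    dsimp only at h
    rw [h]
    split_ifs with hlev
    · rw [mul_inv_rev, conjInv_mul (C.isClifford_levelPrefix _ _).inv
        (isClifford_unitaryPart _).inv, ih (by omega), C.conjInv_unitaryPart_inv_measured hlev]
    · rw [one_mul, ih (by omega)]

/-- The operations of level at most `ℓ` are the first `t` operations. -/
def IsLevelCut (ℓ t : ℕ) : Prop := t ≤ C.size ∧ ∀ i : Fin C.size, (i : ℕ) < t ↔ C.level i ≤ ℓ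

theorem exists_isLevelCut (ℓ : ℕ) : ∃ t, C.IsLevelCut ℓ t := by
  by_cases h : ∃ i, ℓ < C.level i
  · obtain ⟨i₀, hi₀⟩ := h
    obtain ⟨i, hi, hmin⟩ := Finset.exists_min_image
      (Finset.univ.filter fun i => ℓ < C.level i) id ⟨i₀, by simpa using hi₀⟩
    simp only [Finset.mem_filter, Finset.mem_univ, true_and, id] at hi hmin
    refine ⟨i, i.2.le, fun k => ⟨fun hk => ?_, fun hk => ?_⟩⟩
    · by_contra hlt
      exact absurd (hmin k (not_le.1 hlt)) (not_le.2 hk)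
    · by_contra hlt
      have := C.level_mono (not_lt.1 hlt : i ≤ k)
      omega
  · push Not at h
    exact ⟨C.size, le_rfl, fun i => ⟨fun _ => h i, fun _ => i.2⟩⟩

theorem levelPrefix_eq_one {ℓ t : ℕ} (ht : C.IsLevelCut ℓ t) : C.levelPrefix (ℓ + 1) t = 1 := by
  rw [levelPrefix]
  refine List.prod_eq_one fun U hU => ?_
  obtain ⟨i, hi, rfl⟩ := List.mem_map.1 hU
  rw [List.mem_reverse] at hi
  obtain ⟨k, hk, rfl⟩ := List.mem_iff_getElem.1 hi
  rw [if_neg]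
  have := (ht.2 ⟨k, by simp at hk; omega⟩).1 (by simp at hk ⊢; omega)
  simp
  omega

theorem levelPrefix_eq_levelUnitary {ℓ t : ℕ} (ht : C.IsLevelCut ℓ t) :
    C.levelPrefix ℓ t = C.levelUnitary ℓ := by
  have key : ∀ r, t ≤ r → r ≤ C.size → C.levelPrefix ℓ r = C.levelPrefix ℓ t := by
    intro r htr
    induction r, htr using Nat.le_induction with
    | base => exact fun _ => rfl
    | succ r htr ih =>
      intro hr
      have h := C.levelPrefix_succ ℓ ⟨r, hr⟩
      dsimp only at h
      rw [h, if_neg, one_mul, ih (by omega)]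
      intro hlev
      have := (ht.2 ⟨r, hr⟩).2 hlev.le
      exact absurd this (not_lt.2 htr)
  rw [← key C.size ht.1 le_rfl, levelPrefix_size]

/-- Propagation of the accumulated measurements through one level. -/
theorem accum_level_succ {ℓ t t' : ℕ} (ht : C.IsLevelCut ℓ t) (ht' : C.IsLevelCut (ℓ + 1) t')
    (w : C.Meas → ZMod 2) :
    C.accum t' w = conjInv (C.levelUnitary (ℓ + 1))⁻¹ (C.accum t w +
      ∑ j : C.Meas, if C.level j.1 = ℓ + 1 then w j • (C.measured j).pauli else 0) := by
  have htt' : t ≤ t' := by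
    by_contra hlt
    have hlt' : t' < C.size := by have := ht.1; omega
    have h1 := (ht.2 ⟨t', hlt'⟩).1 (not_le.1 hlt)
    exact absurd ((ht'.2 ⟨t', hlt'⟩).2 (by omega)) (lt_irrefl _)
  -- Induction over the operations of level `ℓ + 1`, with the gates of that level met so far
  -- collected in `levelPrefix`.
  have key : ∀ r, t ≤ r → r ≤ t' → C.accum r w = conjInv (C.levelPrefix (ℓ + 1) r)⁻¹
      (C.accum t w + ∑ j : C.Meas, if C.level j.1 = ℓ + 1 ∧ (j.1 : ℕ) < r then
        w j • (C.measured j).pauli else 0) := by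
    intro r htr
    induction r, htr using Nat.le_induction with
    | base =>
      intro _
      rw [C.levelPrefix_eq_one ht, inv_one, conjInv_one, Finset.sum_eq_zero, add_zero]
      intro j _
      refine if_neg fun h => ?_
      have := (ht.2 j.1).1 h.2
      omega
    | succ r htr ih =>
      intro hr
      have hrs : r < C.size := by have := ht'.1; omega
      have hlev : C.level ⟨r, hrs⟩ = ℓ + 1 := by
        have h1 := (ht'.2 ⟨r, hrs⟩).1 hr
        have h2 : ¬ C.level ⟨r, hrs⟩ ≤ ℓ := fun h => absurd ((ht.2 ⟨r, hrs⟩).2 h) (not_lt.2 htr)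
        omega
      have hpre := C.levelPrefix_succ (ℓ + 1) ⟨r, hrs⟩
      rw [if_pos hlev] at hpre
      dsimp only at hpre
      have hcl := C.isClifford_levelPrefix (ℓ + 1) r
      by_cases hm : (C.op ⟨r, hrs⟩).IsMeasurement
      · let j₀ : C.Meas := ⟨⟨r, hrs⟩, hm⟩
        have hone : (C.op ⟨r, hrs⟩).unitaryPart = 1 := by
          cases hop : C.op ⟨r, hrs⟩ with
          | gate g => rw [hop] at hm; exact hm.elim
          | measure S => rfl
        have hsum : (∑ j : C.Meas, if C.level j.1 = ℓ + 1 ∧ (j.1 : ℕ) < r + 1 then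
            w j • (C.measured j).pauli else 0) =
            (∑ j : C.Meas, if C.level j.1 = ℓ + 1 ∧ (j.1 : ℕ) < r then
              w j • (C.measured j).pauli else 0) + w j₀ • (C.measured j₀).pauli := by
          have h2 : ∑ j : C.Meas, (if j = j₀ then w j • (C.measured j).pauli else 0) =
              w j₀ • (C.measured j₀).pauli := by
            rw [Finset.sum_ite_eq' Finset.univ j₀, if_pos (Finset.mem_univ _)]
          rw [← h2, ← Finset.sum_add_distrib]
          refine Finset.sum_congr rfl fun j _ => ?_
          by_cases hj : j = j₀
          · subst hj
            rw [if_pos ⟨hlev, Nat.lt_succ_self r⟩, if_neg (fun h => lt_irrefl _ h.2), if_pos rfl,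
              zero_add]
          · have hj' : (j.1 : ℕ) ≠ r := fun h => hj (Subtype.ext (Fin.ext h))
            have : (j.1 : ℕ) < r + 1 ↔ (j.1 : ℕ) < r := by omega
            rw [if_neg hj, add_zero]
            simp only [this]
        -- A measured operator is fixed by the gates of its own level, so it may be counted as if it
        -- preceded all of them.
        have hfix : conjInv (C.levelPrefix (ℓ + 1) r)⁻¹ (w j₀ • (C.measured j₀).pauli) =
            w j₀ • (C.measured j₀).pauli := by
          have h1 : conjInv (C.levelPrefix (ℓ + 1) r)⁻¹ (C.measured j₀).pauli =
              (C.measured j₀).pauli := hlev ▸ C.conjInv_levelPrefix_measured r hrs.le j₀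
          exact ((conjInvHom _ hcl.inv).map_smul _ _).trans (congrArg _ h1)
        have hacc := C.accum_succ_measure j₀ w
        dsimp only [j₀] at hacc
        rw [hacc, ih (by omega), hpre, hone, one_mul, hsum, ← add_assoc]
        conv_rhs => rw [conjInv_add hcl.inv, hfix]
      · have hacc := C.accum_succ_gate hm w
        dsimp only at hacc
        have hsum : ∀ j : C.Meas, (j.1 : ℕ) < r + 1 ↔ (j.1 : ℕ) < r := by
          intro j
          have : (j.1 : ℕ) ≠ r := fun h => hm ((Fin.ext h : j.1 = ⟨r, hrs⟩) ▸ j.2)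
          omega
        rw [hacc, ih (by omega), hpre, mul_inv_rev,
          conjInv_mul hcl.inv (isClifford_unitaryPart _).inv]
        simp only [hsum]
  rw [key t' htt' le_rfl, C.levelPrefix_eq_levelUnitary ht']
  congr 2
  refine Finset.sum_congr rfl fun j _ => ?_
  have : C.level j.1 = ℓ + 1 ∧ (j.1 : ℕ) < t' ↔ C.level j.1 = ℓ + 1 :=
    and_iff_left_of_imp fun h => (ht'.2 j.1).2 h.le
  simp only [this]

/-- If the accumulated measurements of `u` are trivial at the end of the circuit, then the
back-cumulant of `F(u)` consists of the accumulated measurements. -/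
theorem slice_checkOperator {u : C.Meas → ZMod 2} (hu : C.accum C.size u = 0)
    (x : Fin (C.depth + 1)) {t : ℕ} (ht : C.IsLevelCut x t) :
    C.slice (C.checkOperator u) x = C.accum t u := by
  induction x using Fin.reverseInduction generalizing t with
  | last =>
    have hsize : t = C.size := by
      by_contra hne
      have hlt : t < C.size := lt_of_le_of_ne ht.1 hne
      exact absurd ((ht.2 ⟨t, hlt⟩).2 (C.level_le_depth _)) (lt_irrefl _)
    -- No measurement has level `Δ + 1`, so the last slice is trivial, as is the accumulated
    -- operator by hypothesis.
    rw [hsize, hu, checkOperator, slice_backCumulant_last, slice_measFault]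
    refine Finset.sum_eq_zero fun j _ => if_neg fun h => ?_
    have := C.level_le_depth j.1
    rw [Fin.val_last] at h
    omega
  | cast k ih =>
    obtain ⟨t', ht'⟩ := C.exists_isLevelCut (k + 1)
    have ih' := ih (t := t') (by rwa [Fin.val_succ])
    rw [checkOperator] at ih' ⊢
    -- With `m` the measured part of level `k + 1` and `a` the operator accumulated before it, the
    -- forward rule gives `U (a + m) U⁻¹` after the level. Undoing the conjugation and adding `m`
    -- once more leaves `a` in characteristic 2.
    rw [slice_backCumulant_castSucc, ih', C.accum_level_succ (ℓ := k) ht ht',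
      conjInv_conjInv_inv (C.isClifford_levelUnitary _), slice_measFault, Fin.val_castSucc,
      add_comm, add_assoc, ZModModule.add_self, add_zero]

theorem comm_eq_sum_slice (P R : PauliBar C.FaultQubit) :
    P.comm R = ∑ x, (C.slice P x).comm (C.slice R x) := by
  rw [PauliBar.comm, Fintype.sum_prod_type]
  rfl

variable {C}

/-- The check operators found by the algorithm commute. -/
theorem CheckRun.comm_checkOperator {R : List ((C.Meas → ZMod 2) × ZMod 2)} (h : C.CheckRun R) :
    ∀ c ∈ R, ∀ c' ∈ R, (C.checkOperator c.1).comm (C.checkOperator c'.1) = 0 := by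
  intro c hc c' hc'
  rw [comm_eq_sum_slice]
  refine Finset.sum_eq_zero fun x _ => ?_
  obtain ⟨t, ht⟩ := C.exists_isLevelCut x
  rw [C.slice_checkOperator (h.accum_eq_zero c hc) x ht,
    C.slice_checkOperator (h.accum_eq_zero c' hc') x ht]
  exact h.comm_eq_zero c hc c' hc' t ht.1

/-- The check operators found by the algorithm generate the stabilizers of the spacetime code. -/
theorem CheckRun.stabilizers_eq_span {R : List ((C.Meas → ZMod 2) × ZMod 2)} (h : C.CheckRun R)
    (hlin : C.HasLinearOutcomeCode) : C.stabilizers =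
      Submodule.span (ZMod 2) {P | P ∈ R.map fun c => C.checkOperator c.1} := by
  have himage : {P | P ∈ R.map fun c => C.checkOperator c.1} =
      C.checkHom '' {u | ∃ b, (u, b) ∈ R} := by
    ext P
    simp only [Set.mem_ofPred_eq, List.mem_map, Set.mem_image, Prod.exists, checkHom_apply]
    exact ⟨fun ⟨u, b, hb, h⟩ => ⟨u, ⟨b, hb⟩, h⟩, fun ⟨u, ⟨b, hb⟩, h⟩ => ⟨u, b, hb, h⟩⟩
  rw [himage, Submodule.span_image, Submodule.map_coe, ← h.outcomeDual_eq_span hlin]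
  rfl

/-! ### Supports in the spacetime graph -/

variable (C) in
theorem vertexQubit_injective : Function.Injective C.vertexQubit := fun v w h =>
  Prod.ext (Fin.castSucc_injective _ (congrArg Prod.fst h : v.1.castSucc = w.1.castSucc))
    (congrArg Prod.snd h : (C.vertexQubit v).2 = (C.vertexQubit w).2)

theorem HasConnectedSupport.exists_ball {F : PauliBar C.FaultQubit} (h : C.HasConnectedSupport F)
    {M : ℕ} (hM : F.weight ≤ M) : ∃ v, F ∈ PauliBar.supportedOn (C.ballQubits v (M / 2)) := by
  classical
  set s : Finset C.Vertex := Finset.univ.filter fun v => F (C.vertexQubit v) ≠ 0 with hs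
  have hcoe : (s : Set C.Vertex) = C.graphSupport F := by
    ext v
    simp [hs, graphSupport]
  have hcard : s.card ≤ M := by
    refine le_trans ?_ hM
    rw [← Finset.card_image_of_injective s C.vertexQubit_injective]
    refine Finset.card_le_card fun x hx => ?_
    obtain ⟨v, hv, rfl⟩ := Finset.mem_image.1 hx
    exact PauliBar.mem_support.2 (Finset.mem_filter.1 hv).2
  obtain ⟨v, hv⟩ := SimpleGraph.exists_edist_le_of_induce_connected s (hcoe ▸ h.2) hcard
  refine ⟨v, fun x hx => ?_⟩
  by_contra hne
  obtain ⟨w, rfl⟩ := h.1 x hne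
  refine hx ?_
  rw [ballQubits]
  exact Finset.mem_image_of_mem _ (Finset.mem_filter.2 ⟨Finset.mem_univ _,
    hv w (Finset.mem_filter.2 ⟨Finset.mem_univ _, hne⟩)⟩)

theorem hasConnectedSupport_iff {F : PauliBar C.FaultQubit} {v : C.Vertex} {r : ℕ}
    (hF : F ∈ PauliBar.supportedOn (C.ballQubits v r)) : C.HasConnectedSupport F ↔
      Nat.card (C.spacetimeGraph.induce (C.graphSupport F)).ConnectedComponent = 1 := by
  rw [SimpleGraph.connected_iff_card_connectedComponent]
  refine and_iff_right fun x hx => ?_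
  have hmem : x ∈ C.ballQubits v r := by
    by_contra h
    exact hx (hF x h)
  rw [ballQubits] at hmem
  obtain ⟨w, -, hw⟩ := Finset.mem_image.1 hmem
  exact ⟨w, hw⟩

end CliffordCircuit

/-! ### The main theorem -/

theorem mainTheorem8 {n : ℕ} (C : CliffordCircuit n) (hlin : C.HasLinearOutcomeCode) (M : ℕ) :
    (∃ out, C.LowWeightRun M out) ∧
      ∀ out, C.LowWeightRun M out →
        out = {F | F ∈ C.stabilizers ∧ C.HasConnectedSupport F ∧ F.weight ≤ M} := by
  constructor
  · obtain ⟨R, hR⟩ := C.exists_checkRun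
    obtain ⟨K, X, Z, hXZ⟩ := exists_isLogicalBasis (R.map fun c => C.checkOperator c.1) (by
      intro P hP P' hP'
      obtain ⟨c, hc, rfl⟩ := List.mem_map.1 hP
      obtain ⟨c', hc', rfl⟩ := List.mem_map.1 hP'
      exact hR.comm_checkOperator c hc c' hc')
    choose SA hSA using fun v => exists_restrictedRun (R.map fun c => C.checkOperator c.1) X Z
      (C.ballQubits v (M / 2))
    exact ⟨_, R, K, X, Z, SA, hR, hXZ, hSA, rfl⟩
  · rintro _ ⟨R, K, X, Z, SA, hR, hXZ, hSA, rfl⟩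
    ext F
    simp only [Set.mem_ofPred_eq]
    rw [hR.stabilizers_eq_span hlin]
    constructor
    · rintro ⟨v, hF, hweight, hcomp⟩
      obtain ⟨hFS, hFA⟩ := ((hSA v).mem_span_iff hXZ F).1 hF
      exact ⟨hFS, (CliffordCircuit.hasConnectedSupport_iff hFA).2 hcomp, hweight⟩
    · rintro ⟨hFS, hconn, hweight⟩
      obtain ⟨v, hFA⟩ := hconn.exists_ball hweight
      exact ⟨v, ((hSA v).mem_span_iff hXZ F).2 ⟨hFS, hFA⟩, hweight,
        (CliffordCircuit.hasConnectedSupport_iff hFA).1 hconn⟩
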